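/- **Setting.** Let $Z\in\mathbb R^m$ be instruments and $X\in\mathbb R^d$ a proper subvector of $Z$; let $(U_0,U_1,U_D)$ be real random variables such that $Z$ is independent of $(U_0,U_1,U_D)$; let $F_{U_D}$, the distribution function of $U_D$, be strictly increasing with $V:=F_{U_D}(U_D)$ uniform on $[0,1]$. Let $D=\mathbf 1\{\mu_D(Z)-U_D\ge 0\}$ with $\mu_D$ measurable, $P(Z)=F_{U_D}(\mu_D(Z))$, $Y_j=\beta_j'X+U_j$ with $E|Y_j|<\infty$ and $E[Y_j\mid X]=\beta_j'X$ ($j=0,1$), $Y=DY_1+(1-D)Y_0$, $\tilde Y=Y-\beta_0'X-(\beta_1-\beta_0)'X\,P(Z)$, $m(p)=E[\tilde Y\mid P(Z)=p]$, $\varepsilon=\tilde Y-m(P(Z))$, $\sigma^2(p)=E[\varepsilon^2\mid P(Z)=p]$. Let $\mathcal P=[a_0,b_0]$ with $0<a_0<b_0<1$, let $K:\mathbb R\to\mathbb R$, let $h_n=Cn^{-\eta}$, and put $\kappa_2(K)=\int u^2K(u)\,du$. Assume: 1. $P(Z)$ has a Lebesgue density $f_P$ on $(0,1)$ which is bounded,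 bounded away from zero and twice continuously differentiable with bounded second derivative; 2. $\sigma^2$ is continuous on $\mathcal P$, $\sup_{p\in(0,1)}E[|\varepsilon|^4\mid P(Z)=p]<\infty$, and $\sigma^2f_P$ is Lipschitz on $(0,1)$; 3. $m$ is three times continuously differentiable on $(0,1)$ with bounded derivatives of orders one to three; 4. $K$ is compactly supported, bounded, symmetric around zero and six times differentiable; 5. $C>0$, $\frac17<\eta<\frac16$, and $h_n\le1$ for all $n\ge1$; 6. with $s_n(p)\ge0$ given by $s_n^2(p)=\frac{1}{h_n^3f_P^2(p)\kappa_2^2(K)}E\big[\varepsilon^2K^2\big(\tfrac{P(Z)-p}{h_n}\big)(P(Z)-p)^2\big]$, one has $\inf_{n\ge1}\inf_{p\in\mathcal P}s_n(p)>0$, and each $s_n$ is continuous on $\mathcal P$. Let $c_n(p)=\big\{h_n^{-3}E\big[\varepsilon^2K^2\big(\tfrac{P(Z)-p}{h_n}\big)(P(Z)-p)^2\big]\big\}^{-1/2}$ and $$\rho(x)=\frac{\int uK(u)(u-x)K(u-x)\,du}{\int u^2K^2(u)\,du}.$$ **Lemma.** (i) For every $n\ge1$ there is a tight mean-zero Gaussian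 random element $\tilde B_{n,1}$ of $\ell^\infty(\mathcal P)$ with covariance $$E[\tilde B_{n,1}(p)\tilde B_{n,1}(\check p)]=h_n^{-3}c_n(p)c_n(\check p)\,E\Big[\varepsilon^2K\big(\tfrac{P(Z)-p}{h_n}\big)K\big(\tfrac{P(Z)-\check p}{h_n}\big)(P(Z)-p)(P(Z)-\check p)\Big],\qquad p,\check p\in\mathcal P.$$ (ii) For all sufficiently large $n$ there is a tight mean-zero Gaussian random element $\tilde B_{n,2}$ of $\ell^\infty(h_n^{-1}\mathcal P)$ with stationary covariance $E[\tilde B_{n,2}(p)\tilde B_{n,2}(\check p)]=\rho(p-\check p)$ for $p,\check p\in h_n^{-1}\mathcal P$. (iii) Let $(\tilde W_{n,1})_{n\ge1}$ be any sequence of random variables on a common probability space such that, for each $n\ge1$, $\tilde W_{n,1}$ is equal in distribution to $\sup_{p\in\mathcal P}\tilde B_{n,1}(p)$. Then, after enlarging this probability space by an independent random variable uniform on $[0,1]$, there is a sequence $\tilde W_{n,2}$ of random variables such that, for all large $n$, $\tilde W_{n,2}$ is equal in distribution to $\sup_{p\in\mathcal P}\tilde B_{n,2}(h_n^{-1}p)$,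 and, as $n\to\infty$, $$|\tilde W_{n,1}-\tilde W_{n,2}|=O_P\Big\{h_n^{1/2}\sqrt{\log h_n^{-3/2}}\Big\}.$$ -/

import Mathlib

open MeasureTheory ProbabilityTheory Set Filter Topology
open scoped ENNReal

namespace MTE

noncomputable section

/-! ### The econometric model (population version) -/

/-- The primitives of the generalized Roy model on a sample space `Ω`: instruments `Z`, covariates
`X` (coordinates of `Z`, selected by `sel`), unobservables `U₀, U₁, U_D`, the selection index
`μ_D` and the coefficients `β₀, β₁` of the outcome equations. -/
structure Model (Ω : Type*) (d m : ℕ) where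
  Z : Ω → Fin m → ℝ
  sel : Fin d → Fin m
  U0 : Ω → ℝ
  U1 : Ω → ℝ
  UD : Ω → ℝ
  muD : (Fin m → ℝ) → ℝ
  beta0 : Fin d → ℝ
  beta1 : Fin d → ℝ

namespace Model

variable {Ω : Type*} [MeasurableSpace Ω] {d m : ℕ}

/-- Covariates: a subvector of the instruments. -/
def X (M : Model Ω d m) (ω : Ω) : Fin d → ℝ := fun j => M.Z ω (M.sel j)

/-- The linear index `β' x`. -/
def lin (β x : Fin d → ℝ) : ℝ := ∑ j, β j * x j

/-- Untreated potential outcome `Y₀ = β₀' X + U₀`. -/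
def Y0 (M : Model Ω d m) (ω : Ω) : ℝ := lin M.beta0 (M.X ω) + M.U0 ω

/-- Treated potential outcome `Y₁ = β₁' X + U₁`. -/
def Y1 (M : Model Ω d m) (ω : Ω) : ℝ := lin M.beta1 (M.X ω) + M.U1 ω

open Classical in
/-- Treatment: `D = 1` if `μ_D(Z) - U_D ≥ 0`, and `D = 0` otherwise. -/
def D (M : Model Ω d m) (ω : Ω) : ℝ := if 0 ≤ M.muD (M.Z ω) - M.UD ω then 1 else 0

/-- Observed outcome. -/
def Y (M : Model Ω d m) (ω : Ω) : ℝ := M.D ω * M.Y1 ω + (1 - M.D ω) * M.Y0 ω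

/-- Distribution function of `U_D`. -/
def FUD (M : Model Ω d m) (μ : Measure Ω) (t : ℝ) : ℝ := cdf (μ.map M.UD) t

/-- `V = F_{U_D}(U_D)`. -/
def V (M : Model Ω d m) (μ : Measure Ω) (ω : Ω) : ℝ := M.FUD μ (M.UD ω)

/-- The propensity score `P(Z) = F_{U_D}(μ_D(Z))` as a random variable. -/
def P (M : Model Ω d m) (μ : Measure Ω) (ω : Ω) : ℝ := M.FUD μ (M.muD (M.Z ω))

/-- `Ỹ = Y - β₀' X - (β₁ - β₀)' X P(Z)`. -/
def Ytilde (M : Model Ω d m) (μ : Measure Ω) (ω : Ω) : ℝ :=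
  M.Y ω - lin M.beta0 (M.X ω) - lin (M.beta1 - M.beta0) (M.X ω) * M.P μ ω

/-- The error `ε = Ỹ - m(P(Z))`, where `mreg` is the regression function `m`. -/
def eps (M : Model Ω d m) (μ : Measure Ω) (mreg : ℝ → ℝ) (ω : Ω) : ℝ :=
  M.Ytilde μ ω - mreg (M.P μ ω)

/-- Conditional expectation given the propensity score. -/
def condP (M : Model Ω d m) (μ : Measure Ω) (f : Ω → ℝ) : Ω → ℝ :=
  μ[f | MeasurableSpace.comap (M.P μ) inferInstance]

/-- The assumptions of the framework. Independence of `Z` (which contains `X`) from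
`(U₀, U₁, U_D)` amounts to conditional independence of `(U₀, U₁, V)` and `Z` given `X` together
with independence of `X` and `(U₀, U₁, V)`. -/
structure Framework (M : Model Ω d m) (μ : Measure Ω) : Prop where
  measurable_Z : Measurable M.Z
  measurable_U0 : Measurable M.U0
  measurable_U1 : Measurable M.U1
  measurable_UD : Measurable M.UD
  measurable_muD : Measurable M.muD
  sel_injective : Function.Injective M.sel
  excluded_instrument : ∃ k, k ∉ range M.sel
  indep : IndepFun M.Z (fun ω => (M.U0 ω, M.U1 ω, M.UD ω)) μ
  strictMono_FUD : StrictMono (M.FUD μ)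
  uniform_V : μ.map (M.V μ) = volume.restrict (Icc (0 : ℝ) 1)
  integrable_Y0 : Integrable M.Y0 μ
  integrable_Y1 : Integrable M.Y1 μ
  mean_Y0 : μ[M.Y0 | MeasurableSpace.comap M.X inferInstance] =ᵐ[μ]
    fun ω => lin M.beta0 (M.X ω)
  mean_Y1 : μ[M.Y1 | MeasurableSpace.comap M.X inferInstance] =ᵐ[μ]
    fun ω => lin M.beta1 (M.X ω)

/-- `E[ε² K((P(Z) - p)/h) K((P(Z) - q)/h) (P(Z) - p) (P(Z) - q)]`. -/
def crossMoment (M : Model Ω d m) (μ : Measure Ω) (mreg K : ℝ → ℝ) (h p q : ℝ) : ℝ :=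
  ∫ ω, M.eps μ mreg ω ^ 2 * K ((M.P μ ω - p) / h) * K ((M.P μ ω - q) / h)
    * (M.P μ ω - p) * (M.P μ ω - q) ∂μ

/-- `κ₂(K) = ∫ u² K(u) du`. -/
def kappa2 (K : ℝ → ℝ) : ℝ := ∫ u, u ^ 2 * K u

/-- The standard deviation `s_n(p)` for bandwidth `h`. -/
def sn (M : Model Ω d m) (μ : Measure Ω) (mreg fP K : ℝ → ℝ) (h p : ℝ) : ℝ :=
  Real.sqrt (1 / (h ^ 3 * fP p ^ 2 * kappa2 K ^ 2) * M.crossMoment μ mreg K h p p)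

/-- The normalization `c_n(p)` for bandwidth `h`. -/
def cn (M : Model Ω d m) (μ : Measure Ω) (mreg K : ℝ → ℝ) (h p : ℝ) : ℝ :=
  (1 / h ^ 3 * M.crossMoment μ mreg K h p p) ^ (-(1 / 2) : ℝ)

/-- Covariance function of the process `B̃_{n,1}` for bandwidth `h`. -/
def cov1 (M : Model Ω d m) (μ : Measure Ω) (mreg K : ℝ → ℝ) (h p q : ℝ) : ℝ :=
  1 / h ^ 3 * M.cn μ mreg K h p * M.cn μ mreg K h q * M.crossMoment μ mreg K h p q

end Model

/-- Bandwidth `h_n = C n^{-η}`. -/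
def bw (C η : ℝ) (n : ℕ) : ℝ := C * (n : ℝ) ^ (-η)

/-- The regularity conditions on the region `[a₀, b₀]`, the density `fP` of `P(Z)`, the regression
function `mreg` of `Ỹ` on `P(Z)`, the conditional variance `sigma2`, the kernel `K` and the
bandwidths. -/
structure Regularity {Ω : Type*} [MeasurableSpace Ω] {d m : ℕ} (M : Model Ω d m) (μ : Measure Ω)
    (a₀ b₀ C η : ℝ) (fP mreg sigma2 K : ℝ → ℝ) : Prop where
  a_pos : 0 < a₀
  a_lt_b : a₀ < b₀
  b_lt_one : b₀ < 1
  -- density of the propensity score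
  density : μ.map (M.P μ) =
    (volume.restrict (Ioo (0 : ℝ) 1)).withDensity (fun p => ENNReal.ofReal (fP p))
  density_bounded : ∃ B, ∀ p ∈ Ioo (0 : ℝ) 1, fP p ≤ B
  density_lower : ∃ c > 0, ∀ p ∈ Ioo (0 : ℝ) 1, c ≤ fP p
  density_smooth : ContDiffOn ℝ 2 fP (Ioo 0 1)
  density_deriv2 : ∃ B, ∀ p ∈ Ioo (0 : ℝ) 1, |iteratedDeriv 2 fP p| ≤ B
  -- conditional mean
  mreg_version : (fun ω => mreg (M.P μ ω)) =ᵐ[μ] M.condP μ (M.Ytilde μ)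
  mreg_smooth : ContDiffOn ℝ 3 mreg (Ioo 0 1)
  mreg_deriv : ∃ B, ∀ k ∈ Finset.Icc 1 3, ∀ p ∈ Ioo (0 : ℝ) 1, |iteratedDeriv k mreg p| ≤ B
  -- conditional variance and fourth moment
  eps4_integrable : Integrable (fun ω => M.eps μ mreg ω ^ 4) μ
  eps4_bounded : ∃ B : ℝ, ∀ᵐ ω ∂μ, M.condP μ (fun ω' => M.eps μ mreg ω' ^ 4) ω ≤ B
  sigma2_version : (fun ω => sigma2 (M.P μ ω)) =ᵐ[μ] M.condP μ (fun ω => M.eps μ mreg ω ^ 2)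
  sigma2_continuous : ContinuousOn sigma2 (Icc a₀ b₀)
  sigma2_density_lipschitz : ∃ L, LipschitzOnWith L (fun p => sigma2 p * fP p) (Ioo 0 1)
  -- kernel
  kernel_compact : HasCompactSupport K
  kernel_bounded : ∃ B, ∀ u, |K u| ≤ B
  kernel_symm : ∀ u, K (-u) = K u
  kernel_diff : ∀ k < 6, Differentiable ℝ (iteratedDeriv k K)
  -- bandwidth
  C_pos : 0 < C
  eta_lower : 1 / 7 < η
  eta_upper : η < 1 / 6
  bw_le_one : ∀ n : ℕ, 1 ≤ n → bw C η n ≤ 1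
  -- asymptotic standard deviation
  sn_lower : ∃ c > 0, ∀ n : ℕ, 1 ≤ n → ∀ p ∈ Icc a₀ b₀, c ≤ M.sn μ mreg fP K (bw C η n) p
  sn_continuous : ∀ n : ℕ, 1 ≤ n →
    ContinuousOn (fun p => M.sn μ mreg fP K (bw C η n) p) (Icc a₀ b₀)

/-! ### Tight Gaussian processes, stochastic order -/

/-- The space `ℓ^∞(T)` of bounded real functions on `T`, with the supremum norm. -/
abbrev EllInf (T : Set ℝ) : Type := lp (fun _ : T => ℝ) ∞

/-- `ℓ^∞(T)` carries its Borel σ-algebra. -/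
instance instMeasurableSpaceEllInf (T : Set ℝ) : MeasurableSpace (EllInf T) := borel _

instance instBorelSpaceEllInf (T : Set ℝ) : BorelSpace (EllInf T) := ⟨rfl⟩

/-- `B` is a tight (Borel measurable) Gaussian random element of `ℓ^∞(T)` with mean zero and
covariance function `c`. -/
structure IsTightGaussian {Ω : Type*} [MeasurableSpace Ω] (ν : Measure Ω) (T : Set ℝ)
    (B : Ω → EllInf T) (c : ℝ → ℝ → ℝ) : Prop where
  isProbabilityMeasure : IsProbabilityMeasure ν
  measurable : Measurable B
  tight : IsTightMeasureSet {ν.map B}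
  gaussian : IsGaussianProcess (fun (t : T) ω => B ω t) ν
  mean_zero : ∀ t : T, ∫ ω, B ω t ∂ν = 0
  covariance : ∀ s t : T, ∫ ω, B ω s * B ω t ∂ν = c s t

/-- `ξ_n = O_P(r_n)` as `n → ∞`. -/
def IsBigOP {Ω : Type*} [MeasurableSpace Ω] (μ : Measure Ω) (ξ : ℕ → Ω → ℝ) (r : ℕ → ℝ) : Prop :=
  ∀ ε : ℝ, 0 < ε → ∃ A : ℝ, 0 < A ∧
    ∀ᶠ n in atTop, μ {ω | A * r n < |ξ n ω|} ≤ ENNReal.ofReal ε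

/-- `ρ(x) = ∫ u K(u) (u - x) K(u - x) du / ∫ u² K²(u) du`. -/
def rho (K : ℝ → ℝ) (x : ℝ) : ℝ :=
  (∫ u, u * K u * ((u - x) * K (u - x))) / ∫ u, u ^ 2 * K u ^ 2

/-- The rescaled region `h⁻¹ [a₀, b₀]`. -/
def scaled (a₀ b₀ h : ℝ) : Set ℝ := (fun p => h⁻¹ * p) '' Icc a₀ b₀

/-- For `p ∈ [a₀, b₀]`, the point `h⁻¹ p` of the rescaled region. -/
def scale {a₀ b₀ : ℝ} (h : ℝ) (p : Icc a₀ b₀) : scaled a₀ b₀ h :=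
  ⟨h⁻¹ * p, mem_image_of_mem _ p.2⟩

end

end MTE

/-!
Write `k(u) = u K(u)`, `g = σ² f_P`, and let `W` be a white noise on `ℝ`. Conditioning on `P(Z)`
turns the cross moments into integrals against `g`, so both processes are white noise integrals
of explicit functions. With
`F_p(x) = h^{-1/2} k((x - p)/h) √g(x) 1_{(0,1)}(x)` and `E_p(x) = h^{-1/2} k((x - p)/h)` in `L²(ℝ)`,
the first covariance is `⟪F_p/‖F_p‖, F_q/‖F_q‖⟫` (`Regularity.cov1_eq`), and the stationary one at
`p/h, q/h` is `⟪E_p, E_q⟫ / ∫ k²` (`rho_eq`). The white noise is an isometry from `L²(ℝ)` into centred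
Gaussian variables (`exists_isonormal`); applying it to both curves couples the two processes.

Everything about sample paths follows from one elementary maximal inequality
(`lintegral_norm_sq_le`): if a curve `f : [a, b] → H` is bounded by `s` and `L`-Lipschitz, the
associated continuous process `X` satisfies `E sup X² ≤ s² + 2 s L (b - a)`, because `X²` telescopes
along a grid and `E |X(t')² - X(t)²| ≤ ‖f(t') - f(t)‖ ‖f(t') + f(t)‖`. Applied to the tails of an
orthonormal expansion it yields continuous versions (`exists_continuous_version`), hence tight
Gaussian elements of `ℓ^∞` (`isTightGaussian_reindex`). Applied to the difference
`F_p/‖F_p‖ - E_p/√(∫ k²)`, whose norm is `O(h)` and whose Lipschitz constant is `O(1)` since `g` is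
Lipschitz and `‖F_p‖²` is bounded below (`exists_diffCurve_bound`), it gives
`E sup |difference|² = O(h)`. The suprema therefore differ by `O_P(h^{1/2})`, which is better than the
stated rate by the factor `√(log h^{-3/2})`.

The supremum of *any* tight Gaussian element with the given covariance has the law of the supremum
constructed here, since tightness reduces the supremum to countably many indices
(`IsTightGaussian.identDistrib_iSup`). A variable with that law is then completed to a coupled pair
by sampling from a conditional distribution with the extra uniform variable (`exists_coupling`).
-/

namespace MTE

/-! ### The isonormal Gaussian process of a Hilbert space -/

lemma integral_norm_le_norm_Lp_two {Ω : Type*} [MeasurableSpace Ω] {ν : Measure Ω}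
    [IsProbabilityMeasure ν] (Z : Lp ℝ 2 ν) : ∫ ω, ‖Z ω‖ ∂ν ≤ ‖Z‖ := by
  rw [integral_norm_eq_lintegral_enorm (Lp.aestronglyMeasurable Z), Lp.norm_def,
    ← eLpNorm_one_eq_lintegral_enorm]
  exact ENNReal.toReal_mono (Lp.eLpNorm_ne_top Z)
    (eLpNorm_le_eLpNorm_of_exponent_le (by norm_num) (Lp.aestronglyMeasurable Z))

lemma norm_sq_Lp_two {Ω : Type*} [MeasurableSpace Ω] {ν : Measure Ω} (Z : Lp ℝ 2 ν) :
    ‖Z‖ ^ 2 = ∫ ω, Z ω ^ 2 ∂ν := by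
  rw [← real_inner_self_eq_norm_sq, L2.inner_def]
  simp [pow_two]

lemma integrable_exp_I_mul {Ω : Type*} [MeasurableSpace Ω] {ν : Measure Ω}
    [IsProbabilityMeasure ν] {X : Ω → ℝ} (hX : AEStronglyMeasurable X ν) :
    Integrable (fun ω => Complex.exp (Complex.I * (X ω : ℂ))) ν := by
  refine Integrable.of_bound (C := 1) ?_ (ae_of_all _ fun ω => ?_)
  · have : Continuous fun x : ℝ => Complex.exp (Complex.I * (x : ℂ)) := by fun_prop
    exact this.comp_aestronglyMeasurable hX
  · rw [mul_comm, Complex.norm_exp_ofReal_mul_I]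

lemma continuous_charFun_map_Lp {Ω : Type*} [MeasurableSpace Ω] {ν : Measure Ω}
    [IsProbabilityMeasure ν] (t : ℝ) :
    Continuous fun X : Lp ℝ 2 ν => charFun (ν.map X) t := by
  have key (X : Lp ℝ 2 ν) :
      charFun (ν.map X) t = ∫ ω, Complex.exp (Complex.I * ((t * X ω : ℝ) : ℂ)) ∂ν := by
    rw [charFun_apply_real, integral_map (Lp.aestronglyMeasurable X).aemeasurable
      (by fun_prop)]
    congr with ω
    push_cast
    ring_nf
  have hint (X : Lp ℝ 2 ν) :
      Integrable (fun ω => Complex.exp (Complex.I * ((t * X ω : ℝ) : ℂ))) ν :=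
    integrable_exp_I_mul ((Lp.aestronglyMeasurable X).const_mul t)
  refine (LipschitzWith.of_dist_le_mul (K := ‖t‖₊) fun X Y => ?_).continuous
  rw [dist_eq_norm, dist_eq_norm, key, key, ← integral_sub (hint X) (hint Y)]
  have hpt (x y : ℝ) : ‖Complex.exp (Complex.I * (x : ℂ)) - Complex.exp (Complex.I * (y : ℂ))‖
      ≤ |x - y| := by
    have h1 : Complex.exp (Complex.I * (x : ℂ)) - Complex.exp (Complex.I * (y : ℂ))
        = Complex.exp (y * Complex.I) * (Complex.exp (Complex.I * ((x - y : ℝ) : ℂ)) - 1) := by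
      rw [mul_sub, ← Complex.exp_add]
      push_cast
      ring_nf
    rw [h1, norm_mul, Complex.norm_exp_ofReal_mul_I, one_mul]
    exact Real.norm_exp_I_mul_ofReal_sub_one_le
  calc ‖∫ ω, (Complex.exp (Complex.I * ((t * X ω : ℝ) : ℂ))
        - Complex.exp (Complex.I * ((t * Y ω : ℝ) : ℂ))) ∂ν‖
      ≤ ∫ ω, |t| * ‖(X - Y) ω‖ ∂ν := by
        refine norm_integral_le_of_norm_le
          ((((Lp.memLp (X - Y)).integrable (by norm_num)).norm).const_mul _) ?_
        filter_upwards [Lp.coeFn_sub X Y] with ω hω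
        refine (hpt _ _).trans (le_of_eq ?_)
        rw [hω, Pi.sub_apply, Real.norm_eq_abs, ← abs_mul, mul_sub]
    _ ≤ |t| * ‖X - Y‖ := by
        rw [integral_const_mul]
        exact mul_le_mul_of_nonneg_left (integral_norm_le_norm_Lp_two _) (abs_nonneg t)

/-- Centred Gaussian variables form a closed subset of `L²`. -/
lemma isClosed_setOf_map_eq_gaussianReal {Ω : Type*} [MeasurableSpace Ω] {ν : Measure Ω}
    [IsProbabilityMeasure ν] :
    IsClosed {X : Lp ℝ 2 ν | ν.map X = gaussianReal 0 (‖X‖₊ ^ 2)} := by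
  have : {X : Lp ℝ 2 ν | ν.map X = gaussianReal 0 (‖X‖₊ ^ 2)} =
      ⋂ t : ℝ, {X : Lp ℝ 2 ν | charFun (ν.map X) t =
        Complex.exp (-(((‖X‖ ^ 2 : ℝ) : ℂ) * t ^ 2 / 2))} := by
    ext X
    have hP : IsProbabilityMeasure (ν.map X) :=
      Measure.isProbabilityMeasure_map (Lp.aestronglyMeasurable X).aemeasurable
    simp only [mem_ofPred_eq, mem_iInter]
    constructor
    · intro h t
      rw [h, charFun_gaussianReal]
      simp
    · intro h
      refine Measure.ext_of_charFun (funext fun t => ?_)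
      rw [h, charFun_gaussianReal]
      simp
  rw [this]
  refine isClosed_iInter fun t => isClosed_eq (continuous_charFun_map_Lp t) (by fun_prop)

/-- Every real Hilbert space embeds isometrically into the centred Gaussian variables of some
probability space. -/
theorem exists_isonormal (H : Type) [NormedAddCommGroup H] [InnerProductSpace ℝ H]
    [CompleteSpace H] :
    ∃ (Ω : Type) (_ : MeasurableSpace Ω) (ν : Measure Ω) (_ : IsProbabilityMeasure ν)
      (J : H →ₗᵢ[ℝ] Lp ℝ 2 ν), ∀ f, ν.map (J f) = gaussianReal 0 (‖f‖₊ ^ 2) := by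
  obtain ⟨w, b, -⟩ := exists_hilbertBasis ℝ H
  obtain ⟨Ω, mΩ, ν, ξ, hξm, hξl, hξi, hν⟩ := exists_iid w (gaussianReal 0 1)
  classical
  have hG (i : w) : HasGaussianLaw (ξ i) ν := (hξl i).hasGaussianLaw
  have hmem (i : w) : MemLp (ξ i) 2 ν := (hG i).memLp_two
  have hmean (i : w) : ∫ ω, ξ i ω ∂ν = 0 := by
    rw [(hξl i).integral_eq, integral_id_gaussianReal]
  have hvar (i : w) : ∫ ω, ξ i ω ^ 2 ∂ν = 1 := by
    have h1 := (hξl i).variance_eq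
    rw [variance_id_gaussianReal, variance_of_integral_eq_zero (hξm i).aemeasurable (hmean i)] at h1
    simpa using h1
  have ho : Orthonormal ℝ fun i => (hmem i).toLp (ξ i) := by
    rw [orthonormal_iff_ite]
    intro i j
    rw [L2.inner_def]
    have h1 : ∫ ω, inner ℝ ((hmem i).toLp (ξ i) ω) ((hmem j).toLp (ξ j) ω) ∂ν
        = ∫ ω, ξ i ω * ξ j ω ∂ν := by
      refine integral_congr_ae ?_
      filter_upwards [(hmem i).coeFn_toLp, (hmem j).coeFn_toLp] with ω h2 h3
      rw [h2, h3]
      simp [mul_comm]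
    rw [h1]
    split_ifs with hij
    · subst hij
      simpa [pow_two] using hvar i
    · rw [(hξi.indepFun hij).integral_fun_mul_eq_mul_integral (hξm i).aestronglyMeasurable
        (hξm j).aestronglyMeasurable, hmean, zero_mul]
  refine ⟨Ω, mΩ, ν, hν, ho.orthogonalFamily.linearIsometry.comp b.repr.toLinearIsometry,
    fun f => ?_⟩
  set J := ho.orthogonalFamily.linearIsometry.comp b.repr.toLinearIsometry with hJ
  have hsum : HasSum (fun i => b.repr f i • (hmem i).toLp (ξ i)) (J f) := by
    have h1 := ho.orthogonalFamily.hasSum_linearIsometry (b.repr f)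
    simp only [LinearIsometry.toSpanSingleton_apply] at h1
    exact h1
  have hmemset := isClosed_setOf_map_eq_gaussianReal.mem_of_tendsto hsum
    (Eventually.of_forall fun s => ?_)
  · rw [mem_ofPred_eq, J.nnnorm_map] at hmemset
    exact hmemset
  · -- a finite linear combination of independent Gaussian variables
    rw [mem_ofPred_eq]
    set S := ∑ i ∈ s, b.repr f i • (hmem i).toLp (ξ i) with hS
    have hSae : S =ᵐ[ν] fun ω => ∑ i : s, b.repr f i * ξ i ω := by
      have h1 : ∀ᵐ ω ∂ν, ∀ i : s, (b.repr f i • (hmem i).toLp (ξ i) : Lp ℝ 2 ν) ω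
          = b.repr f i * ξ i ω := by
        rw [ae_all_iff]
        intro i
        filter_upwards [Lp.coeFn_smul (b.repr f i) ((hmem i).toLp (ξ i)), (hmem i).coeFn_toLp]
          with ω h2 h3
        rw [h2, Pi.smul_apply, h3, smul_eq_mul]
      filter_upwards [Lp.coeFn_finsetSum s fun i => b.repr f i • (hmem i).toLp (ξ i), h1]
        with ω h2 h3
      rw [hS, h2, Finset.sum_apply, ← Finset.sum_coe_sort]
      exact Finset.sum_congr rfl fun i _ => h3 i
    have hi : iIndepFun (fun i : s => ξ i) ν := hξi.precomp Subtype.val_injective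
    have hlaw : HasGaussianLaw (fun ω => ∑ i : s, b.repr f i * ξ i ω) ν := by
      have h1 := (iIndepFun.hasGaussianLaw (X := fun i : s => ξ i) (fun i => hG i) hi).map_fun
        (∑ i : s, (b.repr f i) • ContinuousLinearMap.proj (R := ℝ) (φ := fun _ : s => ℝ) i)
      simpa using h1
    have hSm : ∫ ω, S ω ∂ν = 0 := by
      rw [integral_congr_ae hSae, integral_finsetSum]
      · simp [integral_const_mul, hmean]
      · exact fun i _ => ((hG i).integrable).const_mul _
    have h2 := (hlaw.congr hSae.symm).map_eq_gaussianReal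
    rw [h2, hSm, variance_of_integral_eq_zero (Lp.aestronglyMeasurable S).aemeasurable hSm,
      ← norm_sq_Lp_two, Real.toNNReal_pow (norm_nonneg _), norm_toNNReal]

/-! ### A maximal inequality and continuous versions -/

section ContinuousVersion

variable {H : Type*} [NormedAddCommGroup H] [InnerProductSpace ℝ H]
  {Ω : Type*} [MeasurableSpace Ω] {ν : Measure Ω}
  {a b : ℝ}

/-- The point of index `i` of the grid that cuts `[a, b]` into `N` equal pieces. -/
noncomputable def gridPoint (hab : a ≤ b) (N i : ℕ) : Icc a b :=
  projIcc a b hab (a + (i / N : ℝ) * (b - a))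

lemma dist_gridPoint_succ_le (hab : a ≤ b) (N i : ℕ) :
    dist (gridPoint hab N (i + 1)) (gridPoint hab N i) ≤ (b - a) / N := by
  rw [Subtype.dist_eq, Real.dist_eq]
  refine (abs_projIcc_sub_projIcc hab).trans (le_of_eq ?_)
  have h : (a + ((i + 1 : ℕ) / N : ℝ) * (b - a)) - (a + (i / N : ℝ) * (b - a)) = (b - a) / N := by
    push_cast
    ring
  rw [h, abs_of_nonneg]
  exact div_nonneg (sub_nonneg.2 hab) (Nat.cast_nonneg N)

lemma exists_gridPoint_tendsto (hab : a < b) (p : Icc a b) :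
    ∃ j : ℕ → ℕ, (∀ N, j N ≤ N) ∧ Tendsto (fun N => gridPoint hab.le N (j N)) atTop (𝓝 p) := by
  have hba : 0 < b - a := sub_pos.2 hab
  have hu0 : 0 ≤ ((p : ℝ) - a) / (b - a) := div_nonneg (sub_nonneg.2 p.2.1) hba.le
  have hu1 : ((p : ℝ) - a) / (b - a) ≤ 1 := (div_le_one hba).2 (by linarith [p.2.2])
  refine ⟨fun N => ⌊((p : ℝ) - a) / (b - a) * N⌋₊, fun N => ?_, ?_⟩
  · exact Nat.floor_le_of_le (mul_le_of_le_one_left (Nat.cast_nonneg N) hu1)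
  · have h1 := (tendsto_nat_floor_mul_div_atTop hu0).comp (tendsto_natCast_atTop_atTop (R := ℝ))
    have h2 : Tendsto (fun N : ℕ => a + ((⌊((p : ℝ) - a) / (b - a) * N⌋₊ : ℝ) / N) * (b - a)) atTop
        (𝓝 (p : ℝ)) := by
      have h3 := (h1.mul_const (b - a)).const_add a
      rw [div_mul_cancel₀ _ hba.ne', add_sub_cancel] at h3
      exact h3
    have h4 := (continuous_projIcc (h := hab.le)).continuousAt.tendsto.comp h2
    rw [projIcc_val] at h4
    exact h4

lemma sq_gridPoint_le (hab : a ≤ b) (x : C(Icc a b, ℝ)) (N j : ℕ) (hj : j ≤ N) :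
    x (gridPoint hab N j) ^ 2 ≤ x (gridPoint hab N 0) ^ 2 + ∑ i ∈ Finset.range N,
      |x (gridPoint hab N (i + 1)) ^ 2 - x (gridPoint hab N i) ^ 2| := by
  have h1 := Finset.sum_range_sub (fun i => x (gridPoint hab N i) ^ 2) j
  have h2 : ∑ i ∈ Finset.range j, (x (gridPoint hab N (i + 1)) ^ 2 - x (gridPoint hab N i) ^ 2)
      ≤ ∑ i ∈ Finset.range N,
        |x (gridPoint hab N (i + 1)) ^ 2 - x (gridPoint hab N i) ^ 2| :=
    (Finset.sum_le_sum fun i _ => le_abs_self _).trans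
      (Finset.sum_le_sum_of_subset_of_nonneg (Finset.range_mono hj) fun i _ _ => abs_nonneg _)
  linarith

lemma lintegral_abs_sq_sub_sq_le (J : H →ₗᵢ[ℝ] Lp ℝ 2 ν) (u v : H) :
    ∫⁻ ω, ENNReal.ofReal |(J u ω) ^ 2 - (J v ω) ^ 2| ∂ν
      ≤ ENNReal.ofReal (‖u - v‖ * ‖u + v‖) := by
  have hae : ∀ᵐ ω ∂ν, |(J u ω) ^ 2 - (J v ω) ^ 2| = inner ℝ (|J (u - v)| ω) (|J (u + v)| ω) := by
    filter_upwards [Lp.coeFn_abs (J (u - v)), Lp.coeFn_abs (J (u + v)), Lp.coeFn_sub (J u) (J v),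
      Lp.coeFn_add (J u) (J v)] with ω h1 h2 h3 h4
    rw [h1, h2, map_sub, map_add, h3, h4, Pi.sub_apply, Pi.add_apply]
    change _ = |J u ω + J v ω| * |J u ω - J v ω|
    rw [← abs_mul]
    congr 1
    ring
  have hint : Integrable (fun ω => |(J u ω) ^ 2 - (J v ω) ^ 2|) ν :=
    (L2.integrable_inner (𝕜 := ℝ) |J (u - v)| |J (u + v)|).congr (hae.mono fun _ h => h.symm)
  rw [← ofReal_integral_eq_lintegral_ofReal hint (ae_of_all _ fun _ => abs_nonneg _)]
  refine ENNReal.ofReal_le_ofReal ?_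
  rw [integral_congr_ae hae, ← L2.inner_def]
  refine (real_inner_le_norm _ _).trans (le_of_eq ?_)
  rw [norm_abs_eq_norm, norm_abs_eq_norm, J.norm_map, J.norm_map]

lemma lintegral_sq_isometry (J : H →ₗᵢ[ℝ] Lp ℝ 2 ν) (u : H) :
    ∫⁻ ω, ENNReal.ofReal ((J u ω) ^ 2) ∂ν = ENNReal.ofReal (‖u‖ ^ 2) := by
  rw [← ofReal_integral_eq_lintegral_ofReal (Lp.memLp (J u)).integrable_sq
    (ae_of_all _ fun _ => sq_nonneg _), ← norm_sq_Lp_two, J.norm_map]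

/-- A maximal inequality for continuous processes whose increments are of the order of the
distance in `L²`: telescoping `X²` along finer and finer grids bounds `X²` by its value at the left
endpoint plus the sum of `|X(t') - X(t)| |X(t') + X(t)|` over neighbouring grid points. -/
theorem lintegral_norm_sq_le (hab : a < b) (J : H →ₗᵢ[ℝ] Lp ℝ 2 ν) {f : Icc a b → H} {s : ℝ}
    {L : NNReal} (hs : ∀ p, ‖f p‖ ≤ s) (hL : LipschitzWith L f) {X : Ω → C(Icc a b, ℝ)}
    (hX : ∀ p, (fun ω => X ω p) =ᵐ[ν] J (f p)) :
    ∫⁻ ω, ENNReal.ofReal (‖X ω‖ ^ 2) ∂ν ≤ ENNReal.ofReal (s ^ 2 + 2 * s * L * (b - a)) := by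
  have hba : 0 < b - a := sub_pos.2 hab
  have hs0 : 0 ≤ s := (norm_nonneg _).trans (hs ⟨a, left_mem_Icc.2 hab.le⟩)
  set t : ℕ → ℕ → Icc a b := gridPoint hab.le with ht
  set S : ℕ → Ω → ℝ≥0∞ := fun N ω => ENNReal.ofReal (X ω (t N 0) ^ 2) +
    ∑ i ∈ Finset.range N, ENNReal.ofReal |X ω (t N (i + 1)) ^ 2 - X ω (t N i) ^ 2| with hS
  have hm (p : Icc a b) : AEMeasurable (fun ω => X ω p) ν :=
    (Lp.aestronglyMeasurable _).aemeasurable.congr (hX p).symm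
  have hdm (p q : Icc a b) :
      AEMeasurable (fun ω => ENNReal.ofReal |X ω p ^ 2 - X ω q ^ 2|) ν :=
    (continuous_abs.measurable.comp_aemeasurable
      (((hm p).pow_const 2).sub ((hm q).pow_const 2))).ennreal_ofReal
  have hSm (N : ℕ) : AEMeasurable (S N) ν := by
    exact ((hm _).pow_const 2).ennreal_ofReal.add
      (Finset.aemeasurable_fun_sum _ fun i _ => hdm _ _)
  have hpt (ω : Ω) : ENNReal.ofReal (‖X ω‖ ^ 2) ≤ liminf (fun N => S N ω) atTop := by
    obtain ⟨p, -, hp⟩ := isCompact_univ.exists_isMaxOn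
      ⟨⟨a, left_mem_Icc.2 hab.le⟩, mem_univ _⟩ (X ω).continuous.abs.continuousOn
    have hnorm : ‖X ω‖ ^ 2 ≤ X ω p ^ 2 := by
      rw [← sq_abs (X ω p)]
      exact pow_le_pow_left₀ (norm_nonneg _)
        ((ContinuousMap.norm_le _ (abs_nonneg _)).2 fun q => hp (mem_univ q)) 2
    refine (ENNReal.ofReal_le_ofReal hnorm).trans ?_
    obtain ⟨j, hj, hjt⟩ := exists_gridPoint_tendsto hab p
    have h1 : Tendsto (fun N => ENNReal.ofReal (X ω (t N (j N)) ^ 2)) atTop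
        (𝓝 (ENNReal.ofReal (X ω p ^ 2))) :=
      ENNReal.tendsto_ofReal ((((X ω).continuous.tendsto p).comp hjt).pow 2)
    rw [← h1.liminf_eq]
    refine liminf_le_liminf (Eventually.of_forall fun N => ?_)
    rw [hS]
    simp only
    rw [← ENNReal.ofReal_sum_of_nonneg fun i _ => abs_nonneg _,
      ← ENNReal.ofReal_add (sq_nonneg _) (Finset.sum_nonneg fun i _ => abs_nonneg _)]
    exact ENNReal.ofReal_le_ofReal (sq_gridPoint_le hab.le (X ω) N (j N) (hj N))
  have hint (N : ℕ) : ∫⁻ ω, S N ω ∂ν ≤ ENNReal.ofReal (s ^ 2 + 2 * s * L * (b - a)) := by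
    rw [hS]
    simp only
    rw [lintegral_add_left' ((hm _).pow_const 2).ennreal_ofReal, lintegral_finsetSum' _ fun i _ =>
      hdm (t N (i + 1)) (t N i)]
    have h0 : ∫⁻ ω, ENNReal.ofReal (X ω (t N 0) ^ 2) ∂ν ≤ ENNReal.ofReal (s ^ 2) := by
      rw [lintegral_congr_ae (g := fun ω => ENNReal.ofReal ((J (f (t N 0)) ω) ^ 2))
        ((hX _).mono fun ω h => by simp only at h ⊢; rw [h]), lintegral_sq_isometry]
      exact ENNReal.ofReal_le_ofReal (pow_le_pow_left₀ (norm_nonneg _) (hs _) 2)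
    have h1 (i : ℕ) : ∫⁻ ω, ENNReal.ofReal |X ω (t N (i + 1)) ^ 2 - X ω (t N i) ^ 2| ∂ν
        ≤ ENNReal.ofReal (L * ((b - a) / N) * (2 * s)) := by
      rw [lintegral_congr_ae (g := fun ω => ENNReal.ofReal
        |(J (f (t N (i + 1))) ω) ^ 2 - (J (f (t N i)) ω) ^ 2|)
        (by filter_upwards [hX (t N (i + 1)), hX (t N i)] with ω h2 h3; rw [h2, h3])]
      refine (lintegral_abs_sq_sub_sq_le J _ _).trans (ENNReal.ofReal_le_ofReal ?_)
      have h4 : ‖f (t N (i + 1)) - f (t N i)‖ ≤ L * ((b - a) / N) := by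
        rw [← dist_eq_norm]
        exact (hL.dist_le_mul _ _).trans
          (mul_le_mul_of_nonneg_left (dist_gridPoint_succ_le hab.le N i) L.coe_nonneg)
      have h5 : ‖f (t N (i + 1)) + f (t N i)‖ ≤ 2 * s :=
        (norm_add_le _ _).trans (by linarith [hs (t N (i + 1)), hs (t N i)])
      exact mul_le_mul h4 h5 (norm_nonneg _) ((norm_nonneg _).trans h4)
    calc _ ≤ ENNReal.ofReal (s ^ 2) + ∑ i ∈ Finset.range N,
          ENNReal.ofReal (L * ((b - a) / N) * (2 * s)) :=
            add_le_add h0 (Finset.sum_le_sum fun i _ => h1 i)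
      _ = ENNReal.ofReal (s ^ 2) + ENNReal.ofReal (N * (L * ((b - a) / N) * (2 * s))) := by
            rw [Finset.sum_const, Finset.card_range, nsmul_eq_mul,
              ENNReal.ofReal_mul (Nat.cast_nonneg N), ENNReal.ofReal_natCast]
      _ = ENNReal.ofReal (s ^ 2 + N * (L * ((b - a) / N) * (2 * s))) := by
            rw [ENNReal.ofReal_add (sq_nonneg _) (by positivity)]
      _ ≤ _ := by
            refine ENNReal.ofReal_le_ofReal ?_
            rcases Nat.eq_zero_or_pos N with h | h
            · subst h
              simp only [CharP.cast_eq_zero, zero_mul, add_zero, le_add_iff_nonneg_right]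
              positivity
            · have hN : (N : ℝ) ≠ 0 := by positivity
              refine le_of_eq ?_
              field_simp
  calc ∫⁻ ω, ENNReal.ofReal (‖X ω‖ ^ 2) ∂ν ≤ ∫⁻ ω, liminf (fun N => S N ω) atTop ∂ν :=
        lintegral_mono hpt
    _ ≤ liminf (fun N => ∫⁻ ω, S N ω ∂ν) atTop := lintegral_liminf_le' hSm
    _ ≤ liminf (fun _ : ℕ => ENNReal.ofReal (s ^ 2 + 2 * s * L * (b - a))) atTop :=
        liminf_le_liminf (Eventually.of_forall hint)
    _ = _ := liminf_const _

lemma norm_sum_inner_smul_le {ι : Type*} {v : ι → H} (hv : Orthonormal ℝ v) (s : Finset ι)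
    (u : H) : ‖∑ i ∈ s, inner ℝ (v i) u • v i‖ ≤ ‖u‖ := by
  refine le_of_sq_le_sq ?_ (norm_nonneg u)
  rw [← real_inner_self_eq_norm_sq, hv.inner_sum]
  refine le_trans (le_of_eq ?_) (hv.sum_inner_products_le (x := u) (s := s))
  refine Finset.sum_congr rfl fun i _ => ?_
  simp [pow_two]

lemma memLp_sum_smul {ι E : Type*} [NormedAddCommGroup E] [NormedSpace ℝ E] (s : Finset ι)
    {ξ : ι → Ω → ℝ} (hξ : ∀ i, MemLp (ξ i) 2 ν) (φ : ι → E) :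
    MemLp (fun ω => ∑ i ∈ s, ξ i ω • φ i) 2 ν := by
  refine memLp_finsetSum (f := fun i ω => ξ i ω • φ i) s fun i _ => ?_
  refine MemLp.of_le_mul (c := ‖φ i‖) (hξ i) ((hξ i).1.smul_const (φ i)) (ae_of_all _ fun ω => ?_)
  rw [norm_smul, mul_comm]

lemma ae_eq_of_tendsto_Lp {ι E : Type*} [NormedAddCommGroup E] [NormedSpace ℝ E] {l : Filter ι}
    [l.NeBot] (A : E →L[ℝ] ℝ) {S : ι → Lp E 2 ν} {X : Lp E 2 ν} (hS : Tendsto S l (𝓝 X))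
    {Y : ι → Lp ℝ 2 ν} {Z : Lp ℝ 2 ν} (hY : Tendsto Y l (𝓝 Z))
    (hSY : ∀ i, (fun ω => A (S i ω)) =ᵐ[ν] Y i) : (fun ω => A (X ω)) =ᵐ[ν] Z := by
  have h1 : Tendsto (fun i => A.compLpL 2 ν (S i)) l (𝓝 (A.compLpL 2 ν X)) :=
    ((A.compLpL 2 ν).continuous.tendsto X).comp hS
  have h2 (i : ι) : A.compLpL 2 ν (S i) = Y i :=
    Lp.ext ((A.coeFn_compLpL (S i)).trans (hSY i))
  simp only [h2] at h1
  rw [tendsto_nhds_unique hY h1]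
  exact (A.coeFn_compLpL X).symm

/-- The `L²` norm of a continuous process is controlled by the maximal inequality. -/
lemma norm_toLp_le [IsProbabilityMeasure ν] (hab : a < b) (J : H →ₗᵢ[ℝ] Lp ℝ 2 ν)
    {f : Icc a b → H} {s : ℝ} {L : NNReal} (hs : ∀ p, ‖f p‖ ≤ s) (hL : LipschitzWith L f)
    (X : Lp C(Icc a b, ℝ) 2 ν) (hX : ∀ p, (fun ω => X ω p) =ᵐ[ν] J (f p)) :
    ‖X‖ ^ 2 ≤ s ^ 2 + 2 * s * L * (b - a) := by
  have hs0 : 0 ≤ s := (norm_nonneg _).trans (hs ⟨a, left_mem_Icc.2 hab.le⟩)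
  have hba : 0 < b - a := sub_pos.2 hab
  have h1 := lintegral_norm_sq_le hab J hs hL hX
  have h2 : ENNReal.ofReal (‖X‖ ^ 2) = ∫⁻ ω, ENNReal.ofReal (‖X ω‖ ^ 2) ∂ν := by
    rw [ENNReal.ofReal_pow (norm_nonneg _), Lp.norm_def, ENNReal.ofReal_toReal
      (Lp.eLpNorm_ne_top X), ← ENNReal.rpow_natCast, Nat.cast_ofNat]
    have h3 := eLpNorm_nnreal_pow_eq_lintegral (f := X) (μ := ν) (p := 2) (by norm_num)
    simp only [ENNReal.coe_ofNat, NNReal.coe_ofNat] at h3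
    rw [h3]
    refine lintegral_congr fun ω => ?_
    rw [ENNReal.ofReal_pow (norm_nonneg _), ofReal_norm, ← ENNReal.rpow_natCast, Nat.cast_ofNat]
  rw [← h2] at h1
  exact (ENNReal.ofReal_le_ofReal_iff (by positivity)).1 h1

/-- A Lipschitz curve in a Hilbert space turns an isonormal process into a process with a
version in `C([a, b])`: the partial sums along a Hilbert basis converge uniformly on the compact
curve, hence in `L²(C([a, b]))` by the maximal inequality. -/
theorem exists_continuous_version [CompleteSpace H] [IsProbabilityMeasure ν] (hab : a < b)
    (J : H →ₗᵢ[ℝ] Lp ℝ 2 ν) {f : Icc a b → H} {L : NNReal} (hL : LipschitzWith L f) :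
    ∃ X : Ω → C(Icc a b, ℝ), StronglyMeasurable X ∧
      ∀ p, (fun ω => X ω p) =ᵐ[ν] J (f p) := by
  classical
  obtain ⟨w, e, -⟩ := exists_hilbertBasis ℝ H
  have hba : 0 < b - a := sub_pos.2 hab
  have he : Orthonormal ℝ e := e.orthonormal
  set T : Finset w → H → H := fun s u => ∑ i ∈ s, inner ℝ (e i) u • e i with hT
  have hTsub (s : Finset w) (u v : H) : T s u - T s v = T s (u - v) := by
    simp [hT, inner_sub_right, sub_smul, Finset.sum_sub_distrib]
  have hTnorm (s : Finset w) (u : H) : ‖T s u‖ ≤ ‖u‖ := norm_sum_inner_smul_le he s u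
  have hTlip (s : Finset w) : LipschitzWith L fun p => T s (f p) := by
    refine LipschitzWith.of_dist_le_mul fun p q => ?_
    rw [dist_eq_norm, hTsub]
    exact (hTnorm s _).trans (by rw [← dist_eq_norm]; exact hL.dist_le_mul p q)
  have hunif : TendstoUniformly (fun s p => T s (f p)) f atTop := by
    have hequi : Equicontinuous fun (s : Finset w) p => T s (f p) :=
      (LipschitzWith.uniformEquicontinuous _ L hTlip).equicontinuous
    have h1 : Tendsto (fun (s : Finset w) p => T s (f p)) atTop (𝓝 f) := by
      rw [tendsto_pi_nhds]
      intro p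
      have := e.hasSum_repr (f p)
      simp only [e.repr_apply_apply] at this
      exact this
    have h2 := (hequi.tendsto_uniformFun_iff_pi atTop f).2 h1
    exact UniformFun.tendsto_iff_tendstoUniformly.1 h2
  -- the partial sums, as random continuous functions
  set φ : w → C(Icc a b, ℝ) := fun i => ⟨fun p => inner ℝ (e i) (f p),
    continuous_const.inner hL.continuous⟩ with hφ
  have hmem (s : Finset w) :
      MemLp (fun ω => ∑ i ∈ s, (J (e i) ω) • φ i) 2 ν :=
    memLp_sum_smul s (fun i => Lp.memLp (J (e i))) φ
  set S : Finset w → Lp C(Icc a b, ℝ) 2 ν := fun s => (hmem s).toLp _ with hS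
  have hSeval (s : Finset w) (p : Icc a b) : (fun ω => S s ω p) =ᵐ[ν] J (T s (f p)) := by
    have h1 : J (T s (f p)) = ∑ i ∈ s, inner ℝ (e i) (f p) • J (e i) := by
      simp [hT, map_sum]
    have h2 : ∀ᵐ ω ∂ν, ∀ i ∈ s, (inner ℝ (e i) (f p) • J (e i) : Lp ℝ 2 ν) ω
        = inner ℝ (e i) (f p) * J (e i) ω := by
      refine (ae_ball_iff s.countable_toSet).2 fun i _ => ?_
      filter_upwards [Lp.coeFn_smul (inner ℝ (e i) (f p)) (J (e i))] with ω h3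
      rw [h3, Pi.smul_apply, smul_eq_mul]
    filter_upwards [(hmem s).coeFn_toLp, Lp.coeFn_finsetSum s fun i =>
      inner ℝ (e i) (f p) • J (e i), h2] with ω h3 h4 h5
    rw [hS]
    simp only
    rw [h3, h1, h4, Finset.sum_apply, ContinuousMap.sum_apply]
    refine Finset.sum_congr rfl fun i hi => ?_
    rw [h5 i hi, ContinuousMap.smul_apply, smul_eq_mul, mul_comm]
    rfl
  have hdiff (s t : Finset w) (δ : ℝ) (hδ : ∀ p, ‖T s (f p) - T t (f p)‖ ≤ δ) :
      ‖S s - S t‖ ^ 2 ≤ δ ^ 2 + 2 * δ * (L + L : NNReal) * (b - a) := by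
    refine norm_toLp_le hab J (f := fun p => T s (f p) - T t (f p)) hδ
      ((hTlip s).sub (hTlip t)) _ fun p => ?_
    filter_upwards [Lp.coeFn_sub (S s) (S t), hSeval s p, hSeval t p,
      Lp.coeFn_sub (J (T s (f p))) (J (T t (f p)))] with ω h1 h2 h3 h4
    rw [h1, map_sub, h4, Pi.sub_apply, Pi.sub_apply, ContinuousMap.sub_apply, h2, h3]
  have hcauchy : CauchySeq S := by
    rw [Metric.cauchySeq_iff']
    intro ε hε
    have hlim : Tendsto (fun δ : ℝ => δ ^ 2 + 2 * δ * (L + L : NNReal) * (b - a)) (𝓝[>] 0)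
        (𝓝 0) := by
      have : Continuous fun δ : ℝ => δ ^ 2 + 2 * δ * (L + L : NNReal) * (b - a) := by fun_prop
      simpa using (this.tendsto 0).mono_left nhdsWithin_le_nhds
    obtain ⟨δ, hδ, hδ0⟩ := ((hlim.eventually (gt_mem_nhds (pow_pos hε 2))).and
      self_mem_nhdsWithin).exists
    obtain ⟨s₀, hs₀⟩ := eventually_atTop.1
      (Metric.tendstoUniformly_iff.1 hunif (δ / 2) (half_pos hδ0))
    refine ⟨s₀, fun s hs => ?_⟩
    rw [dist_eq_norm]
    refine lt_of_pow_lt_pow_left₀ 2 hε.le (lt_of_le_of_lt (hdiff s s₀ δ fun p => ?_) hδ)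
    rw [← dist_eq_norm]
    have h1 := hs₀ s hs p
    have h2 := hs₀ s₀ le_rfl p
    have h3 := dist_triangle_left (T s (f p)) (T s₀ (f p)) (f p)
    linarith
  obtain ⟨X, hX⟩ := cauchySeq_tendsto_of_complete hcauchy
  refine ⟨fun ω => X ω, Lp.stronglyMeasurable X, fun p => ?_⟩
  exact ae_eq_of_tendsto_Lp (ContinuousMap.evalCLM ℝ p) hX
    ((J.continuous.tendsto _).comp (hunif.tendsto_at p)) fun s => hSeval s p

end ContinuousVersion

/-! ### Tight Gaussian elements of `ℓ^∞` -/

section TightGaussian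

variable {a b : ℝ} {T : Set ℝ}

/-- The bounded function `t ↦ x (φ t)` on `T` obtained from a continuous function `x` on `[a, b]`
by a change of index `φ : T → [a, b]`. -/
noncomputable def reindex (φ : T → Icc a b) (x : C(Icc a b, ℝ)) : EllInf T :=
  ⟨fun t => x (φ t), memℓp_infty ⟨‖x‖, by rintro _ ⟨t, rfl⟩; exact x.norm_coe_le_norm _⟩⟩

@[simp] lemma reindex_apply (φ : T → Icc a b) (x : C(Icc a b, ℝ)) (t : T) :
    reindex φ x t = x (φ t) := rfl

lemma continuous_reindex (φ : T → Icc a b) : Continuous (reindex φ) := by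
  refine (LipschitzWith.of_dist_le_mul (K := 1) fun x y => ?_).continuous
  rw [NNReal.coe_one, one_mul, dist_eq_norm, dist_eq_norm]
  refine lp.norm_le_of_forall_le (norm_nonneg _) fun t => ?_
  exact (x - y).norm_coe_le_norm (φ t)

lemma EllInf.abs_apply_le (x : EllInf T) (t : T) : |x t| ≤ ‖x‖ :=
  lp.norm_apply_le_norm ENNReal.top_ne_zero x t

lemma EllInf.bddAbove_range (x : EllInf T) (S : Set T) : BddAbove (range fun t : S => x t) :=
  ⟨‖x‖, by rintro _ ⟨t, rfl⟩; exact (le_abs_self _).trans (x.abs_apply_le t)⟩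

lemma EllInf.abs_iSup_sub_iSup_le {S : Set T} (hS : S.Nonempty) (x y : EllInf T) :
    |(⨆ t : S, x t) - ⨆ t : S, y t| ≤ ‖x - y‖ := by
  have : Nonempty S := hS.to_subtype
  have key (x y : EllInf T) : (⨆ t : S, x t) ≤ (⨆ t : S, y t) + ‖x - y‖ := by
    refine ciSup_le fun t => ?_
    have h1 : x t - y t ≤ ‖x - y‖ := (le_abs_self _).trans ((x - y).abs_apply_le t)
    linarith [le_ciSup (y.bddAbove_range S) t]
  rw [abs_le]
  have h1 := key x y
  have h2 := key y x
  rw [norm_sub_rev] at h2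
  constructor <;> linarith

lemma EllInf.iSup_univ (x : EllInf T) : (⨆ t : (univ : Set T), x t) = ⨆ t : T, x t :=
  (Equiv.Set.univ T).iSup_comp (g := fun t => x t)

lemma EllInf.continuous_iSup {S : Set T} (hS : S.Nonempty) :
    Continuous fun x : EllInf T => ⨆ t : S, x t := by
  refine (LipschitzWith.of_dist_le_mul (K := 1) fun x y => ?_).continuous
  rw [NNReal.coe_one, one_mul, dist_eq_norm, dist_eq_norm]
  exact EllInf.abs_iSup_sub_iSup_le hS x y

lemma EllInf.continuous_apply (t : T) : Continuous fun x : EllInf T => x t := by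
  refine (LipschitzWith.of_dist_le_mul (K := 1) fun x y => ?_).continuous
  rw [NNReal.coe_one, one_mul, dist_eq_norm, dist_eq_norm]
  exact (x - y).abs_apply_le t

variable {H : Type*} [NormedAddCommGroup H] [InnerProductSpace ℝ H]
  {Ω : Type*} [MeasurableSpace Ω] {ν : Measure Ω}

/-- A family of elements of an isonormal process is a Gaussian process. -/
lemma isGaussianProcess_of_isonormal [IsProbabilityMeasure ν] {J : H →ₗᵢ[ℝ] Lp ℝ 2 ν}
    (hJ : ∀ u, ν.map (J u) = gaussianReal 0 (‖u‖₊ ^ 2)) {ι : Type*} (f : ι → H) {X : ι → Ω → ℝ}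
    (hX : ∀ t, X t =ᵐ[ν] J (f t)) : IsGaussianProcess X ν := by
  classical
  refine ⟨fun I => ⟨?_⟩⟩
  have hXm (t : ι) : AEMeasurable (X t) ν :=
    (Lp.aestronglyMeasurable _).aemeasurable.congr (hX t).symm
  have hm : AEMeasurable (fun ω => I.restrict (X · ω)) ν := aemeasurable_pi_lambda _ fun i => hXm i
  refine isGaussian_of_map_eq_gaussianReal fun A => ?_
  set u : H := ∑ i : I, A (Pi.single i 1) • f i with hu
  refine ⟨0, ‖u‖₊ ^ 2, ?_⟩
  rw [AEMeasurable.map_map_of_aemeasurable (by fun_prop) hm, ← hJ u]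
  refine Measure.map_congr ?_
  have h1 : ∀ᵐ ω ∂ν, ∀ i : I, X i ω = J (f i) ω := ae_all_iff.2 fun i => hX i
  have h2 : ∀ᵐ ω ∂ν, ∀ i : I, (A (Pi.single i 1) • J (f i) : Lp ℝ 2 ν) ω
      = A (Pi.single i 1) * J (f i) ω := ae_all_iff.2 fun i => by
    filter_upwards [Lp.coeFn_smul (A (Pi.single i 1)) (J (f i))] with ω h
    rw [h, Pi.smul_apply, smul_eq_mul]
  have h3 : J u = ∑ i : I, A (Pi.single i 1) • J (f i) := by
    simp [hu, map_sum]
  filter_upwards [h1, h2, Lp.coeFn_finsetSum Finset.univ fun i : I => A (Pi.single i 1) • J (f i)]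
    with ω h4 h5 h6
  rw [h3, h6, Finset.sum_apply, Function.comp_apply]
  have h7 : (I.restrict (X · ω)) = ∑ i : I, X i ω • (Pi.single i (1 : ℝ) : I → ℝ) := by
    ext i
    simp [Finset.sum_apply, Pi.single_apply]
  rw [h7, map_sum]
  refine Finset.sum_congr rfl fun i _ => ?_
  rw [map_smul, h5, h4, smul_eq_mul, mul_comm]

lemma integral_isonormal_mul (J : H →ₗᵢ[ℝ] Lp ℝ 2 ν) (u v : H) :
    ∫ ω, J u ω * J v ω ∂ν = inner ℝ u v := by
  rw [← J.inner_map_map, L2.inner_def]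
  refine integral_congr_ae (ae_of_all _ fun ω => ?_)
  change J u ω * J v ω = J v ω * J u ω
  ring

/-- A Lipschitz curve in a Hilbert space defines a tight Gaussian element of `ℓ^∞`. -/
theorem isTightGaussian_reindex [IsProbabilityMeasure ν] {J : H →ₗᵢ[ℝ] Lp ℝ 2 ν}
    (hJ : ∀ u, ν.map (J u) = gaussianReal 0 (‖u‖₊ ^ 2)) {f : Icc a b → H}
    {X : Ω → C(Icc a b, ℝ)} (hXm : StronglyMeasurable X)
    (hX : ∀ p, (fun ω => X ω p) =ᵐ[ν] J (f p)) (φ : T → Icc a b) {c : ℝ → ℝ → ℝ}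
    (hc : ∀ s t : T, c s t = inner ℝ (f (φ s)) (f (φ t))) :
    IsTightGaussian ν T (fun ω => reindex φ (X ω)) c where
  isProbabilityMeasure := inferInstance
  measurable := ((continuous_reindex φ).comp_stronglyMeasurable hXm).measurable
  tight := by
    let _ : MeasurableSpace C(Icc a b, ℝ) := borel _
    have : BorelSpace C(Icc a b, ℝ) := ⟨rfl⟩
    have : IsProbabilityMeasure (ν.map X) :=
      Measure.isProbabilityMeasure_map hXm.measurable.aemeasurable
    have h1 : IsTightMeasureSet {ν.map X} := isTightMeasureSet_singleton
    have h2 := h1.map (continuous_reindex φ)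
    rw [image_singleton, Measure.map_map (continuous_reindex φ).measurable hXm.measurable] at h2
    exact h2
  gaussian := isGaussianProcess_of_isonormal hJ (fun t => f (φ t)) fun t => hX (φ t)
  mean_zero t := by
    have h1 : ∫ ω, J (f (φ t)) ω ∂ν = ∫ x, x ∂(ν.map (J (f (φ t)))) :=
      (integral_map (Lp.aestronglyMeasurable _).aemeasurable
        aestronglyMeasurable_id).symm
    simp only [reindex_apply]
    rw [integral_congr_ae (hX (φ t)), h1, hJ, integral_id_gaussianReal]
  covariance s t := by
    rw [hc, ← integral_isonormal_mul J]
    refine integral_congr_ae ?_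
    filter_upwards [hX (φ s), hX (φ t)] with ω h1 h2
    simp only [reindex_apply]
    rw [h1, h2]

end TightGaussian

/-! ### The supremum of a tight Gaussian element is determined by the covariance -/

section Uniqueness

variable {T : Set ℝ} {Ω : Type*} [MeasurableSpace Ω] {ν : Measure Ω}

/-- For a bounded function the supremum over `T` is approximated by countably many points. -/
lemma EllInf.exists_countable_iSup_eq [Nonempty T] (x : EllInf T) :
    ∃ S : Set T, S.Countable ∧ S.Nonempty ∧ ∀ S' : Set T, S ⊆ S' →
      ⨆ t : S', x t = ⨆ t : T, x t := by
  have h1 (n : ℕ) : ∃ t : T, (⨆ t : T, x t) - 1 / ((n : ℝ) + 1) < x t :=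
    exists_lt_of_lt_ciSup (by
      have : (0 : ℝ) < 1 / ((n : ℝ) + 1) := Nat.one_div_pos_of_nat
      linarith)
  choose t ht using h1
  refine ⟨range t, countable_range t, range_nonempty t, fun S' hS' => ?_⟩
  have hb : BddAbove (range fun t : T => x t) :=
    ⟨‖x‖, by rintro _ ⟨t, rfl⟩; exact (le_abs_self _).trans (x.abs_apply_le t)⟩
  have : Nonempty S' := ⟨⟨t 0, hS' (mem_range_self 0)⟩⟩
  refine le_antisymm (ciSup_le fun s => le_ciSup hb s.1) ?_
  refine le_of_forall_pos_le_add fun ε hε => ?_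
  obtain ⟨n, hn⟩ := exists_nat_one_div_lt hε
  have h2 := le_ciSup (x.bddAbove_range S') ⟨t n, hS' (mem_range_self n)⟩
  linarith [ht n]

/-- The paths of a tight element of `ℓ^∞(T)` almost surely lie in a separable set, so a single
countable subset of `T` carries their suprema. -/
lemma exists_countable_ae_iSup_eq [Nonempty T] [IsFiniteMeasure ν] {B : Ω → EllInf T}
    (hB : Measurable B) (htight : IsTightMeasureSet {ν.map B}) :
    ∃ S : Set T, S.Countable ∧ ∀ S' : Set T, S ⊆ S' →
      ∀ᵐ ω ∂ν, ⨆ t : S', B ω t = ⨆ t : T, B ω t := by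
  rw [isTightMeasureSet_iff_exists_isCompact_measure_compl_le] at htight
  have h1 (n : ℕ) := htight ((n : ℝ≥0∞) + 1)⁻¹ (by simp)
  choose C hC hCle using h1
  have hsep : TopologicalSpace.IsSeparable (⋃ n, C n) :=
    TopologicalSpace.IsSeparable.iUnion fun n => (hC n).isSeparable
  obtain ⟨D, hD, hCD⟩ := hsep
  choose S hS hSne hSsup using fun x : EllInf T => x.exists_countable_iSup_eq
  obtain ⟨x₀⟩ : Nonempty (EllInf T) := inferInstance
  refine ⟨S x₀ ∪ ⋃ x ∈ D, S x, (hS x₀).union (hD.biUnion fun x _ => hS x),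
    fun S' hS' => ?_⟩
  have hS'ne : S'.Nonempty := (hSne x₀).mono (subset_union_left.trans hS')
  have hae : ∀ᵐ ω ∂ν, B ω ∈ ⋃ n, C n := by
    rw [ae_iff]
    refine le_antisymm (ENNReal.le_of_forall_pos_le_add fun ε hε _ => ?_) zero_le
    obtain ⟨n, hn⟩ := ENNReal.exists_inv_nat_lt (a := (ε : ℝ≥0∞)) (by simpa using hε.ne')
    calc ν {ω | B ω ∉ ⋃ n, C n} ≤ ν (B ⁻¹' (C n)ᶜ) :=
          measure_mono fun ω hω h => hω (mem_iUnion.2 ⟨n, h⟩)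
      _ = ν.map B (C n)ᶜ := by rw [Measure.map_apply hB (hC n).measurableSet.compl]
      _ ≤ ((n : ℝ≥0∞) + 1)⁻¹ := hCle n _ rfl
      _ ≤ (n : ℝ≥0∞)⁻¹ := ENNReal.inv_le_inv.2 le_self_add
      _ ≤ 0 + ε := by rw [zero_add]; exact hn.le
  have hclosed : IsClosed {x : EllInf T | ⨆ t : S', x t = ⨆ t : T, x t} := by
    refine isClosed_eq (EllInf.continuous_iSup hS'ne) ?_
    simp only [← EllInf.iSup_univ]
    exact EllInf.continuous_iSup univ_nonempty
  filter_upwards [hae] with ω hω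
  have h2 : closure D ⊆ {x : EllInf T | ⨆ t : S', x t = ⨆ t : T, x t} :=
    hclosed.closure_subset_iff.2 fun x hx =>
      hSsup x S' (((subset_biUnion_of_mem (u := S) hx).trans subset_union_right).trans hS')
  exact h2 (hCD hω)

lemma IsTightGaussian.measurable_apply {B : Ω → EllInf T} {c : ℝ → ℝ → ℝ}
    (h : IsTightGaussian ν T B c) (t : T) : Measurable fun ω => B ω t :=
  (EllInf.continuous_apply t).measurable.comp h.measurable

/-- A linear functional of a finite-dimensional marginal of a centred Gaussian process. -/
lemma IsTightGaussian.map_dual_eq {B : Ω → EllInf T} {c : ℝ → ℝ → ℝ} (h : IsTightGaussian ν T B c)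
    (I : Finset T) [DecidableEq I] (A : StrongDual ℝ (I → ℝ)) :
    ν.map (fun ω => A (I.restrict (fun t => B ω t))) = gaussianReal 0 (Real.toNNReal
      (∑ s : I, ∑ t : I, A (Pi.single s 1) * A (Pi.single t 1) * c s t)) := by
  have hA (ω : Ω) : A (I.restrict (fun t => B ω t)) = ∑ i : I, A (Pi.single i 1) * B ω i := by
    have h1 : I.restrict (fun t => B ω t) = ∑ i : I, B ω i • (Pi.single i (1 : ℝ) : I → ℝ) := by
      ext i
      simp [Finset.sum_apply, Pi.single_apply]
    rw [h1, map_sum]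
    refine Finset.sum_congr rfl fun i _ => ?_
    rw [map_smul, smul_eq_mul, mul_comm]
  have := h.isProbabilityMeasure
  have hm2 (t : T) : MemLp (fun ω => B ω t) 2 ν := (h.gaussian.hasGaussianLaw_eval t).memLp_two
  have hG := (h.gaussian.hasGaussianLaw I).map_fun A
  have hmean : ∫ ω, A (I.restrict (fun t => B ω t)) ∂ν = 0 := by
    rw [integral_congr_ae (ae_of_all _ hA),
      integral_finsetSum _ fun (i : I) _ => ((hm2 i).integrable (by norm_num)).const_mul _]
    simp [integral_const_mul, h.mean_zero]
  rw [hG.map_eq_gaussianReal, hmean, variance_of_integral_eq_zero hG.aemeasurable hmean]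
  congr 2
  have hint (s t : I) : Integrable (fun ω => A (Pi.single s 1) * A (Pi.single t 1) *
      (B ω s * B ω t)) ν := ((hm2 s).integrable_mul (hm2 t)).const_mul _
  calc ∫ ω, A (I.restrict (fun t => B ω t)) ^ 2 ∂ν
      = ∫ ω, ∑ s : I, ∑ t : I, A (Pi.single s 1) * A (Pi.single t 1) * (B ω s * B ω t) ∂ν := by
        refine integral_congr_ae (ae_of_all _ fun ω => ?_)
        simp only
        rw [hA, pow_two, Finset.sum_mul_sum]
        refine Finset.sum_congr rfl fun s _ => Finset.sum_congr rfl fun t _ => ?_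
        ring
    _ = _ := by
        rw [integral_finsetSum _ fun s _ => integrable_finsetSum _ fun t _ => hint s t]
        refine Finset.sum_congr rfl fun s _ => ?_
        rw [integral_finsetSum _ fun t _ => hint s t]
        refine Finset.sum_congr rfl fun t _ => ?_
        rw [integral_const_mul, h.covariance]

/-- Finite-dimensional distributions of centred Gaussian processes depend only on the
covariance. -/
lemma IsTightGaussian.map_restrict_eq {Ω' : Type*} [MeasurableSpace Ω'] {ν' : Measure Ω'}
    {B : Ω → EllInf T} {B' : Ω' → EllInf T} {c : ℝ → ℝ → ℝ} (h : IsTightGaussian ν T B c)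
    (h' : IsTightGaussian ν' T B' c) (I : Finset T) :
    ν.map (fun ω => I.restrict (fun t => B ω t)) = ν'.map (fun ω => I.restrict (fun t => B' ω t)) := by
  classical
  have hm : Measurable fun ω => I.restrict (fun t => B ω t) :=
    measurable_pi_lambda _ fun i => h.measurable_apply i
  have hm' : Measurable fun ω => I.restrict (fun t => B' ω t) :=
    measurable_pi_lambda _ fun i => h'.measurable_apply i
  have := h.isProbabilityMeasure
  have := h'.isProbabilityMeasure
  have := Measure.isProbabilityMeasure_map (μ := ν) hm.aemeasurable
  have := Measure.isProbabilityMeasure_map (μ := ν') hm'.aemeasurable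
  refine Measure.ext_of_charFunDual (funext fun A => ?_)
  rw [charFunDual_eq_charFun_map_one, charFunDual_eq_charFun_map_one,
    Measure.map_map (by fun_prop) hm, Measure.map_map (by fun_prop) hm']
  exact congrArg (fun ρ => charFun ρ 1) ((h.map_dual_eq I A).trans (h'.map_dual_eq I A).symm)

/-- Two tight centred Gaussian elements of `ℓ^∞(T)` with the same covariance have the same
supremum in distribution. -/
theorem IsTightGaussian.identDistrib_iSup [Nonempty T] {Ω' : Type*} [MeasurableSpace Ω']
    {ν' : Measure Ω'} {B : Ω → EllInf T} {B' : Ω' → EllInf T} {c : ℝ → ℝ → ℝ}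
    (h : IsTightGaussian ν T B c) (h' : IsTightGaussian ν' T B' c) :
    IdentDistrib (fun ω => ⨆ t : T, B ω t) (fun ω => ⨆ t : T, B' ω t) ν ν' := by
  have := h.isProbabilityMeasure
  have := h'.isProbabilityMeasure
  obtain ⟨S, hS, hSsup⟩ := exists_countable_ae_iSup_eq h.measurable h.tight
  obtain ⟨S', hS', hSsup'⟩ := exists_countable_ae_iSup_eq h'.measurable h'.tight
  have hc : Countable (S ∪ S' : Set T) := (hS.union hS').to_subtype
  have hm : Measurable fun ω (t : T) => B ω t := measurable_pi_lambda _ h.measurable_apply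
  have hm' : Measurable fun ω (t : T) => B' ω t := measurable_pi_lambda _ h'.measurable_apply
  have hid : IdentDistrib (fun ω (t : T) => B ω t) (fun ω (t : T) => B' ω t) ν ν' := by
    refine ⟨hm.aemeasurable, hm'.aemeasurable, ?_⟩
    have := Measure.isProbabilityMeasure_map (μ := ν) hm.aemeasurable
    have h1 := isProjectiveLimit_map (X := fun (t : T) ω => B ω t) (P := ν) hm.aemeasurable
    have h2 := isProjectiveLimit_map (X := fun (t : T) ω => B' ω t) (P := ν') hm'.aemeasurable
    have h3 : (fun I : Finset T => ν.map fun ω => I.restrict (fun t => B ω t)) =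
        fun I => ν'.map fun ω => I.restrict (fun t => B' ω t) :=
      funext fun I => h.map_restrict_eq h' I
    rw [h3] at h1
    exact h1.unique h2
  have hsup : Measurable fun x : T → ℝ => ⨆ t : (S ∪ S' : Set T), x t :=
    Measurable.iSup fun t => measurable_pi_apply _
  have h1 : IdentDistrib (fun ω => ⨆ t : (S ∪ S' : Set T), B ω t)
      (fun ω => ⨆ t : (S ∪ S' : Set T), B' ω t) ν ν' := hid.comp hsup
  refine ⟨h1.aemeasurable_fst.congr (hSsup _ subset_union_left),
    h1.aemeasurable_snd.congr (hSsup' _ subset_union_right), ?_⟩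
  rw [← Measure.map_congr (hSsup _ subset_union_left),
    ← Measure.map_congr (hSsup' _ subset_union_right), h1.map_eq]

end Uniqueness

/-! ### Transfer of couplings -/

/-- Any variable with the law of `Y₁` can be completed, with the help of an independent uniform
variable, to a pair with the joint law of `(Y₁, Y₂)`. -/
theorem exists_coupling {Ω Ω' : Type*} [MeasurableSpace Ω] [MeasurableSpace Ω'] {ν : Measure Ω}
    [IsProbabilityMeasure ν] {μ' : Measure Ω'} [IsProbabilityMeasure μ'] {Y₁ Y₂ : Ω → ℝ}
    (hY₂ : AEMeasurable Y₂ ν) {W₁ : Ω' → ℝ} (hW : IdentDistrib W₁ Y₁ μ' ν) :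
    ∃ W₂ : Ω' × unitInterval → ℝ, IdentDistrib (fun ω => (W₁ ω.1, W₂ ω))
      (fun ω => (Y₁ ω, Y₂ ω)) (μ'.prod volume) ν := by
  obtain ⟨g, hg, hgκ⟩ := (condDistrib Y₂ Y₁ ν).exists_measurable_map_eq_unitInterval
  have hW₁ : AEMeasurable (fun ω : Ω' × unitInterval => (W₁ ω.1, ω.2)) (μ'.prod volume) :=
    (hW.aemeasurable_fst.comp_quasiMeasurePreserving Measure.quasiMeasurePreserving_fst).prodMk
      measurable_snd.aemeasurable
  have hG : Measurable fun x : ℝ × unitInterval => (x.1, g x.1 x.2) :=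
    measurable_fst.prodMk hg
  refine ⟨fun ω => g (W₁ ω.1) ω.2, hG.comp_aemeasurable hW₁,
    hW.aemeasurable_snd.prodMk hY₂, ?_⟩
  have h1 : (μ'.prod (volume : Measure unitInterval)).map (fun ω => (W₁ ω.1, ω.2))
      = (ν.map Y₁).prod volume := by
    have hind : IndepFun (fun ω : Ω' × unitInterval => W₁ ω.1) (fun ω => ω.2)
        (μ'.prod volume) := indepFun_prod₀ hW.aemeasurable_fst aemeasurable_id
    have hf : AEMeasurable (fun ω : Ω' × unitInterval => W₁ ω.1) (μ'.prod volume) :=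
      hW.aemeasurable_fst.comp_quasiMeasurePreserving Measure.quasiMeasurePreserving_fst
    rw [(indepFun_iff_map_prod_eq_prod_map_map hf measurable_snd.aemeasurable).1 hind,
      ← hW.map_eq]
    congr 1
    · change Measure.map (W₁ ∘ Prod.fst) _ = _
      rw [← AEMeasurable.map_map_of_aemeasurable (by simpa using hW.aemeasurable_fst)
        measurable_fst.aemeasurable]
      simp
    · simp
  have h2 : (μ'.prod (volume : Measure unitInterval)).map (fun ω => (W₁ ω.1, g (W₁ ω.1) ω.2))
      = ((ν.map Y₁).prod volume).map (fun x : ℝ × unitInterval => (x.1, g x.1 x.2)) := by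
    rw [← h1, AEMeasurable.map_map_of_aemeasurable hG.aemeasurable hW₁]
    rfl
  have := Measure.isProbabilityMeasure_map (μ := ν) hW.aemeasurable_snd
  rw [h2, ← compProd_map_condDistrib hY₂]
  ext s hs
  rw [Measure.map_apply hG hs, Measure.prod_apply (hG hs), Measure.compProd_apply hs]
  refine lintegral_congr fun x => ?_
  rw [← hgκ x, Measure.map_apply (f := g x) (hg.comp measurable_prodMk_left)
    (measurable_prodMk_left hs)]
  rfl

/-! ### Kernel curves in `L²(ℝ)` -/

section KernelCurves

/-- A Lipschitz function `k` bounded by `B` that vanishes outside `[-R, R]`. -/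
structure IsWindow (k : ℝ → ℝ) (R B : ℝ) (L : NNReal) : Prop where
  pos : 0 < R
  lipschitz : LipschitzWith L k
  bound : ∀ u, |k u| ≤ B
  support : ∀ u, R < |u| → k u = 0

/-- A measurable weight with values in `[0, B]`. -/
structure IsWeight (G : ℝ → ℝ) (B : ℝ) : Prop where
  measurable : Measurable G
  nonneg : ∀ x, 0 ≤ G x
  bound : ∀ x, G x ≤ B

lemma isWeight_one : IsWeight (fun _ => 1) 1 :=
  ⟨measurable_const, fun _ => zero_le_one, fun _ => le_rfl⟩

/-- The function `x ↦ h^{-1/2} k((x - p) / h) G(x)`. -/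
noncomputable def bump (k G : ℝ → ℝ) (h p x : ℝ) : ℝ := (√h)⁻¹ * k ((x - p) / h) * G x

/-- A bound for the `L²` norm of a function living on a small interval. -/
lemma norm_le_of_window (v : Lp ℝ 2 (volume : Measure ℝ)) {ψ : ℝ → ℝ} (hv : v =ᵐ[volume] ψ)
    {p r M : ℝ} (hr : 0 ≤ r) (hM : 0 ≤ M) (hb : ∀ x, |x - p| ≤ r → |ψ x| ≤ M)
    (h0 : ∀ x, r < |x - p| → ψ x = 0) : ‖v‖ ≤ M * √(2 * r) := by
  refine le_of_sq_le_sq ?_ (by positivity)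
  rw [norm_sq_Lp_two, mul_pow, Real.sq_sqrt (by positivity)]
  have h1 : ∫ x, v x ^ 2 ≤ ∫ x, (Icc (p - r) (p + r)).indicator (fun _ => M ^ 2) x := by
    refine integral_mono_ae (Lp.memLp v).integrable_sq
      ((integrable_indicator_iff measurableSet_Icc).2 (integrableOn_const
        (by simp) (by simp))) ?_
    filter_upwards [hv] with x hx
    rw [hx]
    by_cases h : |x - p| ≤ r
    · rw [indicator_of_mem (by rw [abs_le] at h; constructor <;> linarith), ← sq_abs]
      exact pow_le_pow_left₀ (abs_nonneg _) (hb x h) 2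
    · rw [h0 x (not_le.1 h)]
      simp only [ne_eq, OfNat.ofNat_ne_zero, not_false_eq_true, zero_pow]
      exact indicator_nonneg (fun _ _ => sq_nonneg M) x
  refine h1.trans (le_of_eq ?_)
  rw [integral_indicator measurableSet_Icc, setIntegral_const, Real.volume_real_Icc_of_le
    (by linarith), smul_eq_mul]
  ring

variable {k G : ℝ → ℝ} {R B BG : ℝ} {L : NNReal}

lemma IsWindow.bound_nonneg (hk : IsWindow k R B L) : 0 ≤ B := (abs_nonneg _).trans (hk.bound 0)

lemma IsWeight.bound_nonneg (hG : IsWeight G BG) : 0 ≤ BG := (hG.nonneg 0).trans (hG.bound 0)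

lemma IsWindow.continuous (hk : IsWindow k R B L) : Continuous k := hk.lipschitz.continuous

lemma IsWindow.eq_zero_of_lt (hk : IsWindow k R B L) {h p x : ℝ} (hh : 0 < h)
    (hx : R * h < |x - p|) : k ((x - p) / h) = 0 := by
  refine hk.support _ ?_
  rwa [abs_div, abs_of_pos hh, lt_div_iff₀ hh]

lemma IsWindow.abs_sub_le (hk : IsWindow k R B L) {h : ℝ} (hh : 0 < h) (p q x : ℝ) :
    |k ((x - p) / h) - k ((x - q) / h)| ≤ L * (|p - q| / h) := by
  have h1 := hk.lipschitz.dist_le_mul ((x - p) / h) ((x - q) / h)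
  rw [Real.dist_eq, Real.dist_eq] at h1
  refine h1.trans (le_of_eq ?_)
  rw [← sub_div, abs_div, abs_of_pos hh, sub_sub_sub_cancel_left, abs_sub_comm]

lemma measurable_bump (hk : IsWindow k R B L) (hG : IsWeight G BG) (h p : ℝ) :
    Measurable (bump k G h p) :=
  ((hk.continuous.measurable.comp (by fun_prop)).const_mul _).mul hG.measurable

lemma memLp_bump (hk : IsWindow k R B L) (hG : IsWeight G BG) {h : ℝ} (hh : 0 < h) (p : ℝ) :
    MemLp (bump k G h p) 2 volume := by
  have hB := hk.bound_nonneg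
  have hBG := hG.bound_nonneg
  have h1 : MemLp ((Icc (p - R * h) (p + R * h)).indicator
      (fun _ => (√h)⁻¹ * B * BG)) 2 (volume : Measure ℝ) :=
    memLp_indicator_const 2 measurableSet_Icc _ (Or.inr (by simp))
  refine h1.mono (measurable_bump hk hG h p).aestronglyMeasurable (ae_of_all _ fun x => ?_)
  by_cases h2 : |x - p| ≤ R * h
  · rw [indicator_of_mem (by rw [abs_le] at h2; constructor <;> linarith), bump,
      Real.norm_of_nonneg (by positivity : 0 ≤ (√h)⁻¹ * B * BG), Real.norm_eq_abs, abs_mul, abs_mul,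
      abs_of_nonneg (by positivity : 0 ≤ (√h)⁻¹), abs_of_nonneg (hG.nonneg x)]
    gcongr
    · exact hG.nonneg x
    · exact hk.bound _
    · exact hG.bound x
  · rw [bump, hk.eq_zero_of_lt hh (not_le.1 h2)]
    simp

/-- The element `x ↦ h^{-1/2} k((x - p) / h) G(x)` of `L²(ℝ)`. -/
noncomputable def bumpLp (hk : IsWindow k R B L) (hG : IsWeight G BG) {h : ℝ} (hh : 0 < h)
    (p : ℝ) : Lp ℝ 2 (volume : Measure ℝ) := (memLp_bump hk hG hh p).toLp _

lemma coeFn_bumpLp (hk : IsWindow k R B L) (hG : IsWeight G BG) {h : ℝ} (hh : 0 < h) (p : ℝ) :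
    bumpLp hk hG hh p =ᵐ[volume] bump k G h p := (memLp_bump hk hG hh p).coeFn_toLp

lemma integral_comp_add_mul {h : ℝ} (hh : 0 < h) (p : ℝ) (φ : ℝ → ℝ) :
    ∫ u, φ (p + h * u) = h⁻¹ * ∫ x, φ x := by
  rw [Measure.integral_comp_mul_left (fun y => φ (p + y)) h, integral_add_left_eq_self φ p,
    abs_of_pos (inv_pos.2 hh), smul_eq_mul]

lemma inner_bumpLp (hk : IsWindow k R B L) (hG : IsWeight G BG) {h : ℝ} (hh : 0 < h) (p q : ℝ) :
    inner ℝ (bumpLp hk hG hh p) (bumpLp hk hG hh q)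
      = h⁻¹ * ∫ x, k ((x - p) / h) * k ((x - q) / h) * G x ^ 2 := by
  rw [L2.inner_def, ← integral_const_mul]
  refine integral_congr_ae ?_
  filter_upwards [coeFn_bumpLp hk hG hh p, coeFn_bumpLp hk hG hh q] with x h1 h2
  rw [h1, h2]
  change bump k G h q x * bump k G h p x = _
  have h3 : (√h)⁻¹ * (√h)⁻¹ = h⁻¹ := by rw [← mul_inv, Real.mul_self_sqrt hh.le]
  rw [← h3, bump, bump]
  ring

lemma norm_sq_bumpLp (hk : IsWindow k R B L) (hG : IsWeight G BG) {h : ℝ} (hh : 0 < h) (p : ℝ) :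
    ‖bumpLp hk hG hh p‖ ^ 2 = ∫ u, k u ^ 2 * G (p + h * u) ^ 2 := by
  have h1 := integral_comp_add_mul hh p fun x => k ((x - p) / h) * k ((x - p) / h) * G x ^ 2
  rw [← real_inner_self_eq_norm_sq, inner_bumpLp, ← h1]
  congr with u
  rw [add_sub_cancel_left, mul_div_cancel_left₀ _ hh.ne']
  ring

lemma inner_bumpLp_one (hk : IsWindow k R B L) {h : ℝ} (hh : 0 < h) (s t : ℝ) :
    inner ℝ (bumpLp hk isWeight_one hh (h * s)) (bumpLp hk isWeight_one hh (h * t))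
      = ∫ u, k u * k (u - (s - t)) := by
  have h1 := integral_comp_add_mul hh (h * t)
    fun x => k ((x - h * s) / h) * k ((x - h * t) / h) * 1 ^ 2
  rw [inner_bumpLp, ← h1]
  congr with u
  have h2 : (h * t + h * u - h * s) / h = u - (s - t) := by
    field_simp
    ring
  rw [h2, add_sub_cancel_left, mul_div_cancel_left₀ _ hh.ne']
  ring

lemma norm_bumpLp_sub_le (hk : IsWindow k R B L) (hG : IsWeight G BG) {h : ℝ} (hh : 0 < h)
    {p q : ℝ} (hpq : |p - q| ≤ 1) :
    ‖bumpLp hk hG hh p - bumpLp hk hG hh q‖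
      ≤ (√h)⁻¹ * L * h⁻¹ * BG * √(2 * (R * h + 1)) * |p - q| := by
  have hBG := hG.bound_nonneg
  have hR := hk.pos
  have h1 := norm_le_of_window (bumpLp hk hG hh p - bumpLp hk hG hh q)
    (ψ := fun x => bump k G h p x - bump k G h q x) (p := p) (r := R * h + 1)
    (M := (√h)⁻¹ * (L * (|p - q| / h)) * BG) ?_ (by positivity) (by positivity) ?_ ?_
  · refine h1.trans (le_of_eq ?_)
    ring
  · filter_upwards [coeFn_bumpLp hk hG hh p, coeFn_bumpLp hk hG hh q,
      Lp.coeFn_sub (bumpLp hk hG hh p) (bumpLp hk hG hh q)] with x h1 h2 h3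
    rw [h3, Pi.sub_apply, h1, h2]
  · intro x _
    rw [bump, bump, ← sub_mul, ← mul_sub, abs_mul, abs_mul,
      abs_of_nonneg (by positivity : 0 ≤ (√h)⁻¹), abs_of_nonneg (hG.nonneg x)]
    gcongr
    · exact hG.nonneg x
    · exact hk.abs_sub_le hh p q x
    · exact hG.bound x
  · intro x hx
    have h2 : |x - p| ≤ |x - q| + |p - q| := by
      rw [abs_sub_comm p q]
      exact abs_sub_le x q p
    rw [bump, bump, hk.eq_zero_of_lt hh (by linarith), hk.eq_zero_of_lt hh (by linarith)]
    simp

end KernelCurves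

/-! ### Normalized kernel curves and their difference -/

section Normalization

lemma abs_inv_sub_inv_le {u v δ : ℝ} (hδ : 0 < δ) (hu : δ ≤ u) (hv : δ ≤ v) :
    |u⁻¹ - v⁻¹| ≤ |u ^ 2 - v ^ 2| / δ ^ 3 := by
  have hu0 : 0 < u := hδ.trans_le hu
  have hv0 : 0 < v := hδ.trans_le hv
  have h1 : u⁻¹ - v⁻¹ = (v ^ 2 - u ^ 2) / (u * v * (u + v)) := by
    field_simp
    ring
  rw [h1, abs_div, abs_sub_comm, abs_of_pos (by positivity : 0 < u * v * (u + v))]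
  gcongr
  calc δ ^ 3 = δ * δ * δ := by ring
    _ ≤ u * v * (u + v) := by gcongr; linarith

lemma abs_inv_mul_sub_inv_le {n y l j : ℝ} (hj : 0 < j) (hl : 0 < l) (hn : 0 < n)
    (hjn : j ≤ n ^ 2) (hy : 0 ≤ y) :
    |n⁻¹ * y - (√l)⁻¹| ≤ |l * y ^ 2 - n ^ 2| / (j * √l) := by
  have hs : 0 < √l := Real.sqrt_pos.2 hl
  have h1 : n⁻¹ * y - (√l)⁻¹ = (l * y ^ 2 - n ^ 2) / (n * √l * (√l * y + n)) := by
    rw [← Real.sq_sqrt hl.le]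
    simp only [Real.sqrt_sq hs.le]
    field_simp
    ring
  rw [h1, abs_div, abs_of_pos (by positivity : 0 < n * √l * (√l * y + n))]
  refine div_le_div_of_nonneg_left (abs_nonneg _) (by positivity) ?_
  have h2 : 0 ≤ √l * y := by positivity
  calc j * √l ≤ n ^ 2 * √l := by gcongr
    _ = n * √l * n := by ring
    _ ≤ n * √l * (√l * y + n) := by gcongr; linarith

lemma norm_normalize_sub_le {E : Type*} [NormedAddCommGroup E] [NormedSpace ℝ E] {x y : E} {δ : ℝ}
    (hδ : 0 < δ) (hx : δ ≤ ‖x‖) (hy : δ ≤ ‖y‖) :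
    ‖‖x‖⁻¹ • x - ‖y‖⁻¹ • y‖ ≤ 2 * δ⁻¹ * ‖x - y‖ := by
  have hx0 : 0 < ‖x‖ := hδ.trans_le hx
  have hy0 : 0 < ‖y‖ := hδ.trans_le hy
  have h1 : ‖x‖⁻¹ • x - ‖y‖⁻¹ • y = ‖x‖⁻¹ • (x - y) + (‖x‖⁻¹ - ‖y‖⁻¹) • y := by
    rw [smul_sub, sub_smul]
    abel
  have h2 : ‖(‖x‖⁻¹ - ‖y‖⁻¹) • y‖ ≤ ‖x‖⁻¹ * ‖x - y‖ := by
    have h3 : ‖x‖⁻¹ - ‖y‖⁻¹ = (‖y‖ - ‖x‖) * (‖x‖⁻¹ * ‖y‖⁻¹) := by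
      field_simp
    rw [norm_smul, h3, Real.norm_eq_abs, abs_mul,
      abs_of_pos (by positivity : 0 < ‖x‖⁻¹ * ‖y‖⁻¹), mul_assoc, mul_assoc,
      inv_mul_cancel₀ hy0.ne', mul_one, mul_comm, norm_sub_rev]
    gcongr
    exact abs_norm_sub_norm_le y x
  have h3 : ‖x‖⁻¹ ≤ δ⁻¹ := inv_anti₀ hδ hx
  rw [h1]
  refine (norm_add_le _ _).trans ?_
  rw [norm_smul, norm_inv, norm_norm]
  calc ‖x‖⁻¹ * ‖x - y‖ + ‖(‖x‖⁻¹ - ‖y‖⁻¹) • y‖ ≤ 2 * ‖x‖⁻¹ * ‖x - y‖ := by linarith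
    _ ≤ 2 * δ⁻¹ * ‖x - y‖ := by gcongr

variable {k G : ℝ → ℝ} {R B BG : ℝ} {L : NNReal}

lemma IsWindow.integrable_sq (hk : IsWindow k R B L) : Integrable fun u => k u ^ 2 := by
  refine (hk.continuous.pow 2).integrable_of_hasCompactSupport
    (HasCompactSupport.intro (isCompact_Icc (a := -R) (b := R)) fun u hu => ?_)
  rw [Pi.pow_apply, hk.support u (by
    by_contra h
    exact hu (abs_le.1 (not_lt.1 h)))]
  simp

lemma IsWindow.abs_integral_sub_le (hk : IsWindow k R B L) {A A' : ℝ → ℝ} {M δ : ℝ}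
    (hA : Measurable A) (hA' : Measurable A') (hAM : ∀ u, |A u| ≤ M) (hAM' : ∀ u, |A' u| ≤ M)
    (hδ : ∀ u, |u| ≤ R → |A u - A' u| ≤ δ) :
    |(∫ u, k u ^ 2 * A u) - ∫ u, k u ^ 2 * A' u| ≤ (∫ u, k u ^ 2) * δ := by
  have h1 : Integrable fun u => k u ^ 2 * A u :=
    hk.integrable_sq.mul_bdd hA.aestronglyMeasurable (ae_of_all _ hAM)
  have h2 : Integrable fun u => k u ^ 2 * A' u :=
    hk.integrable_sq.mul_bdd hA'.aestronglyMeasurable (ae_of_all _ hAM')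
  rw [← integral_sub h1 h2, ← integral_mul_const, ← Real.norm_eq_abs]
  refine norm_integral_le_of_norm_le (hk.integrable_sq.mul_const δ) (ae_of_all _ fun u => ?_)
  rw [← mul_sub, norm_mul, Real.norm_of_nonneg (sq_nonneg _)]
  by_cases hu : |u| ≤ R
  · exact mul_le_mul_of_nonneg_left (hδ u hu) (sq_nonneg _)
  · rw [hk.support u (not_le.1 hu)]
    simp

/-- The local variance `‖F_p‖²` differs from `∫ k² · G(x)²` by the oscillation of `G²`. -/
lemma abs_mul_sq_sub_norm_sq_le (hk : IsWindow k R B L) (hG : IsWeight G BG) {h : ℝ} (hh : 0 < h)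
    {p x δ : ℝ} (hδ : ∀ u, |u| ≤ R → |G x ^ 2 - G (p + h * u) ^ 2| ≤ δ) :
    |(∫ u, k u ^ 2) * G x ^ 2 - ‖bumpLp hk hG hh p‖ ^ 2| ≤ (∫ u, k u ^ 2) * δ := by
  have hb (y : ℝ) : |G y ^ 2| ≤ BG ^ 2 := by
    rw [abs_of_nonneg (sq_nonneg _)]
    exact pow_le_pow_left₀ (hG.nonneg y) (hG.bound y) 2
  rw [norm_sq_bumpLp, ← integral_mul_const]
  exact hk.abs_integral_sub_le measurable_const
    ((hG.measurable.comp (by fun_prop)).pow_const 2) (fun _ => hb x) (fun u => hb _) hδ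

lemma abs_norm_sq_sub_norm_sq_le (hk : IsWindow k R B L) (hG : IsWeight G BG) {h : ℝ} (hh : 0 < h)
    {p q δ : ℝ} (hδ : ∀ u, |u| ≤ R → |G (p + h * u) ^ 2 - G (q + h * u) ^ 2| ≤ δ) :
    |‖bumpLp hk hG hh p‖ ^ 2 - ‖bumpLp hk hG hh q‖ ^ 2| ≤ (∫ u, k u ^ 2) * δ := by
  have hb (y : ℝ) : |G y ^ 2| ≤ BG ^ 2 := by
    rw [abs_of_nonneg (sq_nonneg _)]
    exact pow_le_pow_left₀ (hG.nonneg y) (hG.bound y) 2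
  rw [norm_sq_bumpLp, norm_sq_bumpLp]
  exact hk.abs_integral_sub_le ((hG.measurable.comp (by fun_prop)).pow_const 2)
    ((hG.measurable.comp (by fun_prop)).pow_const 2) (fun u => hb _) (fun u => hb _) hδ

/-- The difference between the normalized weighted curve `p ↦ F_p / ‖F_p‖` and the normalized
unweighted one, the curve that represents the coupled difference of the two Gaussian processes. -/
noncomputable def diffCurve (hk : IsWindow k R B L) (hG : IsWeight G BG) {h : ℝ} (hh : 0 < h)
    (p : ℝ) : Lp ℝ 2 (volume : Measure ℝ) :=
  ‖bumpLp hk hG hh p‖⁻¹ • bumpLp hk hG hh p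
    - (√(∫ u, k u ^ 2))⁻¹ • bumpLp hk isWeight_one hh p

lemma coeFn_diffCurve (hk : IsWindow k R B L) (hG : IsWeight G BG) {h : ℝ} (hh : 0 < h) (p : ℝ) :
    diffCurve hk hG hh p =ᵐ[volume] fun x => (√h)⁻¹ * k ((x - p) / h) *
      (‖bumpLp hk hG hh p‖⁻¹ * G x - (√(∫ u, k u ^ 2))⁻¹) := by
  filter_upwards [coeFn_bumpLp hk hG hh p, coeFn_bumpLp hk isWeight_one hh p,
    Lp.coeFn_sub (‖bumpLp hk hG hh p‖⁻¹ • bumpLp hk hG hh p)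
      ((√(∫ u, k u ^ 2))⁻¹ • bumpLp hk isWeight_one hh p),
    Lp.coeFn_smul ‖bumpLp hk hG hh p‖⁻¹ (bumpLp hk hG hh p),
    Lp.coeFn_smul (√(∫ u, k u ^ 2))⁻¹ (bumpLp hk isWeight_one hh p)] with x h1 h2 h3 h4 h5
  rw [diffCurve, h3, Pi.sub_apply, h4, h5, Pi.smul_apply, Pi.smul_apply, h1, h2, bump, bump,
    smul_eq_mul, smul_eq_mul]
  ring

/-- For small bandwidths the difference curve has norm `O(h)` and a Lipschitz constant `O(1)`: on
the window of width `O(h)` around `p` the Lipschitz function `G²` is within `O(h)` of its local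
average `‖F_p‖² / ∫ k²`. -/
theorem exists_diffCurve_bound (hk : IsWindow k R B L) (hG : IsWeight G BG) {Lg : ℝ}
    (hLg0 : 0 ≤ Lg)
    (hLg : ∀ x ∈ Ioo (0 : ℝ) 1, ∀ y ∈ Ioo (0 : ℝ) 1, |G x ^ 2 - G y ^ 2| ≤ Lg * |x - y|)
    {a b : ℝ} (ha : 0 < a) (hb : b < 1) {j : ℝ} (hj : 0 < j) (hl : 0 < ∫ u, k u ^ 2) :
    ∃ C h₀ : ℝ, 0 ≤ C ∧ 0 < h₀ ∧ ∀ h (hh : 0 < h), h < h₀ →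
      (∀ p ∈ Icc a b, j ≤ ‖bumpLp hk hG hh p‖ ^ 2) →
      (∀ p ∈ Icc a b, ‖diffCurve hk hG hh p‖ ≤ C * h) ∧
      ∀ p ∈ Icc a b, ∀ q ∈ Icc a b,
        ‖diffCurve hk hG hh p - diffCurve hk hG hh q‖ ≤ C * |p - q| := by
  have hR := hk.pos
  have hB := hk.bound_nonneg
  have hBG := hG.bound_nonneg
  set l := ∫ u, k u ^ 2 with hldef
  have hsl : 0 < √l := Real.sqrt_pos.2 hl
  have hδ : 0 < √j := Real.sqrt_pos.2 hj
  set C₁ := l * (Lg * (2 * R + 1)) / (j * √l) with hC₁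
  set C₂ := l * Lg / √j ^ 3 with hC₂
  set C₃ := B * C₁ * √(2 * R) with hC₃
  set C₄ := (L * C₁ + B * C₂ * BG) * √(2 * (R + 1)) with hC₄
  have hC₁0 : 0 ≤ C₁ := by positivity
  have hC₂0 : 0 ≤ C₂ := by positivity
  have hC₃0 : 0 ≤ C₃ := by positivity
  have hC₄0 : 0 ≤ C₄ := by positivity
  have hL0 : (0 : ℝ) ≤ L := L.coe_nonneg
  refine ⟨2 * C₃ + C₄, min a (1 - b) / (R + 1), by positivity,
    div_pos (lt_min ha (sub_pos.2 hb)) (by positivity), fun h hh hh₀ hjp => ?_⟩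
  have hh1 : (R + 1) * h < min a (1 - b) := by rwa [lt_div_iff₀ (by positivity), mul_comm] at hh₀
  have hRh : R * h ≤ (R + 1) * h := by gcongr; linarith
  have hmem {p x : ℝ} (hp : p ∈ Icc a b) (hx : |x - p| ≤ (R + 1) * h) : x ∈ Ioo (0 : ℝ) 1 := by
    have h1 := hh1.trans_le (min_le_left _ _)
    have h2 := hh1.trans_le (min_le_right _ _)
    rw [abs_le] at hx
    constructor <;> linarith [hp.1, hp.2]
  have hu_abs {u : ℝ} (hu : |u| ≤ R) : |h * u| ≤ R * h := by
    rw [abs_mul, abs_of_pos hh, mul_comm]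
    gcongr
  have hmem' {p u : ℝ} (hp : p ∈ Icc a b) (hu : |u| ≤ R) : p + h * u ∈ Ioo (0 : ℝ) 1 := by
    refine hmem hp ?_
    rw [add_sub_cancel_left]
    exact (hu_abs hu).trans hRh
  have hnorm {p : ℝ} (hp : p ∈ Icc a b) : √j ≤ ‖bumpLp hk hG hh p‖ :=
    (Real.sqrt_le_left (norm_nonneg _)).2 (hjp p hp)
  have hcoef {p x : ℝ} (hp : p ∈ Icc a b) (hx : |x - p| ≤ (R + 1) * h) :
      |‖bumpLp hk hG hh p‖⁻¹ * G x - (√l)⁻¹| ≤ C₁ * h := by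
    refine (abs_inv_mul_sub_inv_le hj hl (hδ.trans_le (hnorm hp)) (hjp p hp) (hG.nonneg x)).trans ?_
    have h1 : |l * G x ^ 2 - ‖bumpLp hk hG hh p‖ ^ 2| ≤ l * (Lg * ((2 * R + 1) * h)) := by
      refine abs_mul_sq_sub_norm_sq_le hk hG hh fun u hu => ?_
      refine (hLg x (hmem hp hx) _ (hmem' hp hu)).trans ?_
      gcongr
      have h2 : x - (p + h * u) = (x - p) - h * u := by ring
      rw [h2]
      refine (abs_sub _ _).trans ?_
      linarith [hu_abs hu]
    calc |l * G x ^ 2 - ‖bumpLp hk hG hh p‖ ^ 2| / (j * √l)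
        ≤ l * (Lg * ((2 * R + 1) * h)) / (j * √l) := by gcongr
      _ = C₁ * h := by rw [hC₁]; ring
  have hinv {p q : ℝ} (hp : p ∈ Icc a b) (hq : q ∈ Icc a b) :
      |‖bumpLp hk hG hh p‖⁻¹ - ‖bumpLp hk hG hh q‖⁻¹| ≤ C₂ * |p - q| := by
    refine (abs_inv_sub_inv_le hδ (hnorm hp) (hnorm hq)).trans ?_
    have h1 : |‖bumpLp hk hG hh p‖ ^ 2 - ‖bumpLp hk hG hh q‖ ^ 2| ≤ l * (Lg * |p - q|) := by
      refine abs_norm_sq_sub_norm_sq_le hk hG hh fun u hu => ?_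
      refine (hLg _ (hmem' hp hu) _ (hmem' hq hu)).trans (le_of_eq ?_)
      congr 2
      ring
    calc |‖bumpLp hk hG hh p‖ ^ 2 - ‖bumpLp hk hG hh q‖ ^ 2| / √j ^ 3
        ≤ l * (Lg * |p - q|) / √j ^ 3 := by gcongr
      _ = C₂ * |p - q| := by rw [hC₂]; ring
  have hsh : 0 < √h := Real.sqrt_pos.2 hh
  have hsize {p : ℝ} (hp : p ∈ Icc a b) : ‖diffCurve hk hG hh p‖ ≤ C₃ * h := by
    have h1 := norm_le_of_window _ (coeFn_diffCurve hk hG hh p) (p := p) (r := R * h)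
      (M := (√h)⁻¹ * B * (C₁ * h)) (by positivity) (by positivity) (fun x hx => ?_)
      (fun x hx => ?_)
    · refine h1.trans (le_of_eq ?_)
      rw [show 2 * (R * h) = (2 * R) * h by ring, Real.sqrt_mul (by positivity), hC₃]
      field_simp
    · rw [abs_mul, abs_mul, abs_of_pos (inv_pos.2 hsh)]
      gcongr
      · exact hk.bound _
      · exact hcoef hp (hx.trans hRh)
    · rw [hk.eq_zero_of_lt hh hx]
      simp
  refine ⟨fun p hp => (hsize hp).trans ?_, fun p hp q hq => ?_⟩
  · gcongr
    linarith
  rcases le_or_gt |p - q| h with hpq | hpq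
  · -- neighbouring points: both windows lie in one window of width `O(h)`
    have h1 := norm_le_of_window (diffCurve hk hG hh p - diffCurve hk hG hh q)
      (ψ := fun x => (√h)⁻¹ * ((k ((x - p) / h) - k ((x - q) / h)) *
        (‖bumpLp hk hG hh p‖⁻¹ * G x - (√l)⁻¹) + k ((x - q) / h) *
        ((‖bumpLp hk hG hh p‖⁻¹ - ‖bumpLp hk hG hh q‖⁻¹) * G x))) (p := p) (r := (R + 1) * h)
      (M := (√h)⁻¹ * ((L * (|p - q| / h)) * (C₁ * h) + B * ((C₂ * |p - q|) * BG))) ?_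
      (by positivity) (by positivity) (fun x hx => ?_) (fun x hx => ?_)
    · refine h1.trans ?_
      rw [show 2 * ((R + 1) * h) = (2 * (R + 1)) * h by ring, Real.sqrt_mul (by positivity)]
      have h2 : (√h)⁻¹ * ((L * (|p - q| / h)) * (C₁ * h) + B * ((C₂ * |p - q|) * BG))
          * (√(2 * (R + 1)) * √h) = C₄ * |p - q| := by
        rw [hC₄]
        field_simp
      rw [h2]
      gcongr
      linarith
    · filter_upwards [coeFn_diffCurve hk hG hh p, coeFn_diffCurve hk hG hh q,
        Lp.coeFn_sub (diffCurve hk hG hh p) (diffCurve hk hG hh q)] with x h1 h2 h3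
      rw [h3, Pi.sub_apply, h1, h2]
      ring
    · rw [abs_mul, abs_of_pos (inv_pos.2 hsh)]
      gcongr
      refine (abs_add_le _ _).trans ?_
      rw [abs_mul, abs_mul, abs_mul, abs_of_nonneg (hG.nonneg x)]
      gcongr
      · exact hk.abs_sub_le hh p q x
      · exact hcoef hp hx
      · have := hG.nonneg x
        positivity
      · exact hk.bound _
      · exact hG.nonneg x
      · exact hinv hp hq
      · exact hG.bound x
    · have h2 : |x - p| ≤ |x - q| + |p - q| := by
        rw [abs_sub_comm p q]
        exact abs_sub_le x q p
      rw [hk.eq_zero_of_lt hh (hRh.trans_lt hx), hk.eq_zero_of_lt hh (by linarith)]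
      simp
  · calc ‖diffCurve hk hG hh p - diffCurve hk hG hh q‖ ≤ C₃ * h + C₃ * h :=
          (norm_sub_le _ _).trans (add_le_add (hsize hp) (hsize hq))
      _ = 2 * C₃ * h := by ring
      _ ≤ 2 * C₃ * |p - q| := by gcongr
      _ ≤ (2 * C₃ + C₄) * |p - q| := by gcongr; linarith

end Normalization

/-! ### The covariance of the first process as an integral -/

section ModelBridge

/-- The function `u ↦ u K(u)`, through which the kernel enters both covariances. -/
def linearKernel (K : ℝ → ℝ) (u : ℝ) : ℝ := u * K u

/-- The square root of `g` on `(0, 1)`, extended by zero. Where `g` is negative the value is `0`, so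
its square is the positive part of `g` on `(0, 1)`, which is still Lipschitz if `g` is. -/
noncomputable def sqrtWeight (g : ℝ → ℝ) : ℝ → ℝ := (Ioo (0 : ℝ) 1).indicator fun x => √(g x)

lemma sq_sqrtWeight_of_mem {g : ℝ → ℝ} {x : ℝ} (hx : x ∈ Ioo (0 : ℝ) 1) :
    sqrtWeight g x ^ 2 = max (g x) 0 := by
  rw [sqrtWeight, indicator_of_mem hx]
  rcases le_total (g x) 0 with h | h
  · rw [Real.sqrt_eq_zero_of_nonpos h, max_eq_right h, zero_pow two_ne_zero]
  · rw [Real.sq_sqrt h, max_eq_left h]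

lemma abs_sq_sqrtWeight_sub_le {g : ℝ → ℝ} {L : NNReal} (hg : LipschitzOnWith L g (Ioo 0 1)) :
    ∀ x ∈ Ioo (0 : ℝ) 1, ∀ y ∈ Ioo (0 : ℝ) 1,
      |sqrtWeight g x ^ 2 - sqrtWeight g y ^ 2| ≤ L * |x - y| := by
  intro x hx y hy
  rw [sq_sqrtWeight_of_mem hx, sq_sqrtWeight_of_mem hy]
  refine (abs_max_sub_max_le_abs _ _ _).trans ?_
  exact hg.dist_le_mul x hx y hy

lemma exists_isWeight_sqrtWeight {g : ℝ → ℝ} {L : NNReal} (hg : LipschitzOnWith L g (Ioo 0 1)) :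
    ∃ B, IsWeight (sqrtWeight g) B := by
  classical
  refine ⟨√(|g (1 / 2)| + L), ?_, fun x => ?_, fun x => ?_⟩
  · have h1 : ContinuousOn (fun x => √(g x)) (Ioo 0 1) :=
      Real.continuous_sqrt.comp_continuousOn hg.continuousOn
    have h2 := h1.measurable_piecewise (g := fun _ => (0 : ℝ)) continuousOn_const measurableSet_Ioo
    rwa [show (fun _ => (0 : ℝ)) = (0 : ℝ → ℝ) from rfl, piecewise_eq_indicator] at h2
  · exact indicator_nonneg (fun _ _ => Real.sqrt_nonneg _) x
  · by_cases hx : x ∈ Ioo (0 : ℝ) 1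
    · rw [sqrtWeight, indicator_of_mem hx]
      refine Real.sqrt_le_sqrt ?_
      have h1 := hg.dist_le_mul x hx (1 / 2) (by norm_num)
      rw [Real.dist_eq, Real.dist_eq] at h1
      have h2 : |x - 1 / 2| ≤ 1 := by
        rw [abs_le]
        constructor <;> linarith [hx.1, hx.2]
      have h3 : (L : ℝ) * |x - 1 / 2| ≤ L := mul_le_of_le_one_right L.coe_nonneg h2
      linarith [abs_sub_abs_le_abs_sub (g x) (g (1 / 2)), le_abs_self (g x)]
    · rw [sqrtWeight, indicator_of_notMem hx]
      exact Real.sqrt_nonneg _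

lemma exists_isWindow_linearKernel {K : ℝ → ℝ} (hK : HasCompactSupport K)
    (hdiff : ∀ k < 6, Differentiable ℝ (iteratedDeriv k K)) :
    ∃ R B L, IsWindow (linearKernel K) R B L := by
  have h0 : Differentiable ℝ K := by simpa using hdiff 0 (by norm_num)
  have h1 : Differentiable ℝ (deriv K) := by simpa using hdiff 1 (by norm_num)
  have hC1 : ContDiff ℝ 1 (linearKernel K) :=
    contDiff_id.mul (contDiff_one_iff_deriv.2 ⟨h0, h1.continuous⟩)
  have hsupp : HasCompactSupport (linearKernel K) := hK.mul_left
  obtain ⟨L, hL⟩ := hC1.lipschitzWith_of_hasCompactSupport hsupp one_ne_zero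
  obtain ⟨B, hB⟩ := hC1.continuous.bounded_above_of_compact_support hsupp
  obtain ⟨R, hR⟩ := hsupp.isCompact.isBounded.subset_closedBall 0
  refine ⟨max R 1, B, L, lt_max_of_lt_right one_pos, hL, hB, fun u hu => ?_⟩
  by_contra h
  have h2 := hR (subset_tsupport _ (Function.mem_support.2 h))
  rw [Metric.mem_closedBall, dist_zero_right, Real.norm_eq_abs] at h2
  exact absurd (h2.trans (le_max_left R 1)) (not_le.2 hu)

variable {Ω : Type*} [MeasurableSpace Ω] {μ : Measure Ω}
  {d m : ℕ} {M : Model Ω d m} {a₀ b₀ C η : ℝ} {fP mreg sigma2 K : ℝ → ℝ}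

lemma Model.Framework.measurable_P (hM : M.Framework μ) : Measurable (M.P μ) :=
  hM.strictMono_FUD.monotone.measurable.comp (hM.measurable_muD.comp hM.measurable_Z)

lemma Regularity.continuousOn_sigma2 (hR : Regularity M μ a₀ b₀ C η fP mreg sigma2 K) :
    ContinuousOn sigma2 (Ioo 0 1) := by
  obtain ⟨L, hL⟩ := hR.sigma2_density_lipschitz
  obtain ⟨c, hc, hcf⟩ := hR.density_lower
  have h1 : ContinuousOn (fun p => sigma2 p * fP p / fP p) (Ioo 0 1) :=
    hL.continuousOn.div hR.density_smooth.continuousOn fun p hp => (hc.trans_le (hcf p hp)).ne'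
  refine h1.congr fun p hp => ?_
  simp only
  rw [mul_div_cancel_right₀ _ (hc.trans_le (hcf p hp)).ne']

lemma Regularity.integrable_eps_sq [IsProbabilityMeasure μ]
    (hR : Regularity M μ a₀ b₀ C η fP mreg sigma2 K) :
    Integrable (fun ω => M.eps μ mreg ω ^ 2) μ := by
  have h1 (ω : Ω) : √(M.eps μ mreg ω ^ 4) = M.eps μ mreg ω ^ 2 := by
    rw [show M.eps μ mreg ω ^ 4 = (M.eps μ mreg ω ^ 2) ^ 2 by ring, Real.sqrt_sq (sq_nonneg _)]
  refine ((integrable_const (1 : ℝ)).add hR.eps4_integrable).mono' ?_ (ae_of_all _ fun ω => ?_)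
  · simp only [← h1]
    exact Real.continuous_sqrt.comp_aestronglyMeasurable hR.eps4_integrable.1
  · rw [Real.norm_of_nonneg (sq_nonneg _), Pi.add_apply]
    nlinarith [sq_nonneg (M.eps μ mreg ω ^ 2 - 1), sq_nonneg (M.eps μ mreg ω ^ 2)]

/-- The density of the propensity score turns the expectation of `ε² ψ(P(Z))` into the integral of
`ψ` against `σ² f_P`. -/
lemma Regularity.integral_eps_sq_mul [IsProbabilityMeasure μ] (hM : M.Framework μ)
    (hR : Regularity M μ a₀ b₀ C η fP mreg sigma2 K) {ψ : ℝ → ℝ} (hψ : Measurable ψ) {B : ℝ}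
    (hB : ∀ x, |ψ x| ≤ B) :
    ∫ ω, M.eps μ mreg ω ^ 2 * ψ (M.P μ ω) ∂μ
      = ∫ x, ψ x * sqrtWeight (fun p => sigma2 p * fP p) x ^ 2 := by
  classical
  set I := Ioo (0 : ℝ) 1 with hI
  have hP := hM.measurable_P
  -- `σ²` and `f_P` are only constrained on `(0, 1)`, so `σ²` is cut off to become measurable
  set s : ℝ → ℝ := I.indicator sigma2 with hs
  have hsm : Measurable s := by
    have h2 := hR.continuousOn_sigma2.measurable_piecewise (g := fun _ => (0 : ℝ))
      continuousOn_const measurableSet_Ioo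
    rwa [show (fun _ => (0 : ℝ)) = (0 : ℝ → ℝ) from rfl, piecewise_eq_indicator] at h2
  have hfm : AEMeasurable (fun p => ENNReal.ofReal (fP p)) (volume.restrict I) :=
    (hR.density_smooth.continuousOn.aemeasurable measurableSet_Ioo).ennreal_ofReal
  obtain ⟨c, hc, hcf⟩ := hR.density_lower
  have hPI : ∀ᵐ ω ∂μ, M.P μ ω ∈ I := by
    refine ae_of_ae_map hP.aemeasurable ?_
    rw [hR.density]
    exact (withDensity_absolutelyContinuous _ _).ae_le (ae_restrict_mem measurableSet_Ioo)
  have hsP : (fun ω => s (M.P μ ω)) =ᵐ[μ] M.condP μ (fun ω => M.eps μ mreg ω ^ 2) := by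
    filter_upwards [hR.sigma2_version, hPI] with ω h1 h2
    rw [hs, indicator_of_mem h2, ← h1]
  have hs0 : ∀ᵐ x ∂(volume.restrict I), 0 ≤ sigma2 x * fP x := by
    have h1 : ∀ᵐ ω ∂μ, 0 ≤ s (M.P μ ω) := by
      have h2 : 0 ≤ᵐ[μ] M.condP μ (fun ω => M.eps μ mreg ω ^ 2) :=
        condExp_nonneg (ae_of_all _ fun ω => sq_nonneg _)
      filter_upwards [hsP, h2] with ω h3 h4
      rw [h3]
      exact h4
    have h2 : ∀ᵐ x ∂(μ.map (M.P μ)), 0 ≤ s x :=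
      (ae_map_iff hP.aemeasurable (measurableSet_le measurable_const hsm)).2 h1
    rw [hR.density, ae_withDensity_iff' hfm] at h2
    filter_upwards [h2, ae_restrict_mem measurableSet_Ioo] with x h3 h4
    have h5 := hc.trans_le (hcf x h4)
    have h6 := h3 (by simpa using h5)
    rw [hs, indicator_of_mem h4] at h6
    exact mul_nonneg h6 h5.le
  have hψP : StronglyMeasurable[MeasurableSpace.comap (M.P μ) inferInstance]
      fun ω => ψ (M.P μ ω) :=
    (hψ.comp (comap_measurable (M.P μ))).stronglyMeasurable
  have hprod : Integrable (fun ω => M.eps μ mreg ω ^ 2 * ψ (M.P μ ω)) μ :=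
    hR.integrable_eps_sq.mul_bdd (hψ.comp hP).aestronglyMeasurable (ae_of_all _ fun ω => hB _)
  have hcond : ∫ ω, M.eps μ mreg ω ^ 2 * ψ (M.P μ ω) ∂μ = ∫ ω, s (M.P μ ω) * ψ (M.P μ ω) ∂μ := by
    rw [← integral_condExp hP.comap_le]
    refine integral_congr_ae ?_
    have h1 := condExp_mul_of_stronglyMeasurable_right hψP hprod hR.integrable_eps_sq
    filter_upwards [h1, hsP] with ω h2 h3
    rw [h3]
    exact h2
  rw [hcond, ← integral_map (f := fun x => s x * ψ x) hP.aemeasurable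
    (hsm.mul hψ).aestronglyMeasurable, hR.density,
    integral_withDensity_eq_integral_toReal_smul₀ hfm (by simp)]
  have hrhs : ∫ x, ψ x * sqrtWeight (fun p => sigma2 p * fP p) x ^ 2
      = ∫ x in I, ψ x * sqrtWeight (fun p => sigma2 p * fP p) x ^ 2 := by
    rw [setIntegral_eq_integral_of_forall_compl_eq_zero]
    intro x hx
    rw [sqrtWeight, indicator_of_notMem hx]
    simp
  rw [hrhs]
  refine integral_congr_ae ?_
  filter_upwards [hs0, ae_restrict_mem measurableSet_Ioo] with x h1 h2
  rw [sq_sqrtWeight_of_mem h2, max_eq_left h1, hs, indicator_of_mem h2,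
    ENNReal.toReal_ofReal (hc.trans_le (hcf x h2)).le, smul_eq_mul]
  ring

variable {R B BG : ℝ} {L : NNReal}

lemma Regularity.crossMoment_eq [IsProbabilityMeasure μ] (hM : M.Framework μ)
    (hR : Regularity M μ a₀ b₀ C η fP mreg sigma2 K) (hk : IsWindow (linearKernel K) R B L)
    (hG : IsWeight (sqrtWeight fun p => sigma2 p * fP p) BG) {h : ℝ} (hh : 0 < h) (p q : ℝ) :
    M.crossMoment μ mreg K h p q
      = h ^ 3 * inner ℝ (bumpLp hk hG hh p) (bumpLp hk hG hh q) := by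
  set ψ : ℝ → ℝ := fun x => h ^ 2 * (linearKernel K ((x - p) / h) * linearKernel K ((x - q) / h))
    with hψ
  have hψm : Measurable ψ :=
    (((hk.continuous.measurable.comp (by fun_prop)).mul
      (hk.continuous.measurable.comp (by fun_prop))).const_mul _)
  have hψB (x : ℝ) : |ψ x| ≤ h ^ 2 * (B * B) := by
    rw [hψ]
    simp only
    rw [abs_mul, abs_mul, abs_of_nonneg (sq_nonneg h)]
    have := hk.bound_nonneg
    gcongr
    · exact hk.bound _
    · exact hk.bound _
  have h1 := hR.integral_eps_sq_mul hM hψm hψB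
  have h2 : M.crossMoment μ mreg K h p q
      = ∫ ω, M.eps μ mreg ω ^ 2 * ψ (M.P μ ω) ∂μ := by
    rw [Model.crossMoment]
    congr with ω
    simp only [hψ, linearKernel]
    field_simp
  rw [h2, h1, inner_bumpLp, hψ]
  simp only [mul_assoc]
  rw [integral_const_mul]
  field_simp

end ModelBridge

/-! ### Representation of the two covariances -/

section Representation

variable {Ω : Type*} [MeasurableSpace Ω] {μ : Measure Ω}
  {d m : ℕ} {M : Model Ω d m} {a₀ b₀ C η : ℝ} {fP mreg sigma2 K : ℝ → ℝ}
  {R B BG : ℝ} {L : NNReal}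

lemma bw_pos (hC : 0 < C) {n : ℕ} (hn : 1 ≤ n) : 0 < bw C η n :=
  mul_pos hC (Real.rpow_pos_of_pos (by exact_mod_cast hn) _)

lemma tendsto_bw (hη : 0 < η) : Tendsto (fun n => bw C η n) atTop (𝓝 0) := by
  have h1 := ((tendsto_rpow_neg_atTop hη).comp (tendsto_natCast_atTop_atTop (R := ℝ))).const_mul C
  rw [mul_zero] at h1
  exact h1

/-- The lower bound on the standard deviation keeps the local variance away from zero. -/
lemma Regularity.exists_le_norm_sq [IsProbabilityMeasure μ] (hM : M.Framework μ)
    (hR : Regularity M μ a₀ b₀ C η fP mreg sigma2 K) (hk : IsWindow (linearKernel K) R B L)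
    (hG : IsWeight (sqrtWeight fun p => sigma2 p * fP p) BG) :
    ∃ j, 0 < j ∧ ∀ n : ℕ, 1 ≤ n → ∀ hh : 0 < bw C η n, ∀ p ∈ Icc a₀ b₀,
      j ≤ ‖bumpLp hk hG hh p‖ ^ 2 := by
  obtain ⟨c, hc, hcs⟩ := hR.sn_lower
  obtain ⟨f, hf, hff⟩ := hR.density_lower
  have key (n : ℕ) (hn : 1 ≤ n) (hh : 0 < bw C η n) (p : ℝ) (hp : p ∈ Icc a₀ b₀) :
      c ^ 2 ≤ ‖bumpLp hk hG hh p‖ ^ 2 / (fP p ^ 2 * Model.kappa2 K ^ 2) := by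
    have h1 := hcs n hn p hp
    rw [Model.sn, hR.crossMoment_eq hM hk hG hh, real_inner_self_eq_norm_sq, Real.le_sqrt' hc] at h1
    refine h1.trans (le_of_eq ?_)
    field_simp
  have ha : a₀ ∈ Icc a₀ b₀ := left_mem_Icc.2 hR.a_lt_b.le
  have hκ : Model.kappa2 K ≠ 0 := by
    intro h0
    have h1 := key 1 le_rfl (bw_pos hR.C_pos le_rfl) a₀ ha
    rw [h0] at h1
    simp only [ne_eq, OfNat.ofNat_ne_zero, not_false_eq_true, zero_pow, mul_zero, div_zero] at h1
    exact absurd h1 (not_le.2 (pow_pos hc 2))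
  refine ⟨c ^ 2 * (f ^ 2 * Model.kappa2 K ^ 2), by positivity, fun n hn hh p hp => ?_⟩
  have hfp := hff p ⟨hR.a_pos.trans_le hp.1, hp.2.trans_lt hR.b_lt_one⟩
  have hfp0 : 0 < fP p := hf.trans_le hfp
  have h1 := key n hn hh p hp
  rw [le_div_iff₀ (by positivity)] at h1
  refine le_trans ?_ h1
  gcongr

lemma Regularity.cov1_eq [IsProbabilityMeasure μ] (hM : M.Framework μ)
    (hR : Regularity M μ a₀ b₀ C η fP mreg sigma2 K) (hk : IsWindow (linearKernel K) R B L)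
    (hG : IsWeight (sqrtWeight fun p => sigma2 p * fP p) BG) {h : ℝ} (hh : 0 < h) (p q : ℝ) :
    M.cov1 μ mreg K h p q = inner ℝ (‖bumpLp hk hG hh p‖⁻¹ • bumpLp hk hG hh p)
      (‖bumpLp hk hG hh q‖⁻¹ • bumpLp hk hG hh q) := by
  have hcn (p : ℝ) : M.cn μ mreg K h p = ‖bumpLp hk hG hh p‖⁻¹ := by
    rw [Model.cn, hR.crossMoment_eq hM hk hG hh, real_inner_self_eq_norm_sq, ← mul_assoc,
      one_div_mul_cancel (pow_pos hh 3).ne', one_mul, Real.rpow_neg (sq_nonneg _),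
      ← Real.sqrt_eq_rpow, Real.sqrt_sq (norm_nonneg _)]
  rw [Model.cov1, hcn, hcn, hR.crossMoment_eq hM hk hG hh, real_inner_smul_left,
    real_inner_smul_right]
  field_simp

lemma rho_eq (hk : IsWindow (linearKernel K) R B L) {h : ℝ} (hh : 0 < h) (s t : ℝ) :
    rho K (s - t) = inner ℝ
      ((√(∫ u, linearKernel K u ^ 2))⁻¹ • bumpLp hk isWeight_one hh (h * s))
      ((√(∫ u, linearKernel K u ^ 2))⁻¹ • bumpLp hk isWeight_one hh (h * t)) := by
  have hl : 0 ≤ ∫ u, linearKernel K u ^ 2 := integral_nonneg fun u => sq_nonneg _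
  rw [real_inner_smul_left, real_inner_smul_right, inner_bumpLp_one, ← mul_assoc, ← mul_inv,
    Real.mul_self_sqrt hl, rho, div_eq_inv_mul]
  simp only [linearKernel, mul_pow]

lemma integral_linearKernel_sq_pos (hk : IsWindow (linearKernel K) R B L) {G : ℝ → ℝ}
    (hG : IsWeight G BG) {h : ℝ} (hh : 0 < h) {p : ℝ} (hp : 0 < ‖bumpLp hk hG hh p‖ ^ 2) :
    0 < ∫ u, linearKernel K u ^ 2 := by
  have h1 : ‖bumpLp hk hG hh p‖ ^ 2 ≤ (∫ u, linearKernel K u ^ 2) * BG ^ 2 := by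
    rw [norm_sq_bumpLp, ← integral_mul_const]
    refine integral_mono_of_nonneg (ae_of_all _ fun u => by positivity)
      (hk.integrable_sq.mul_const _) (ae_of_all _ fun u => ?_)
    exact mul_le_mul_of_nonneg_left (pow_le_pow_left₀ (hG.nonneg _) (hG.bound _) 2) (sq_nonneg _)
  by_contra h2
  have h3 := mul_nonpos_of_nonpos_of_nonneg (not_lt.1 h2) (sq_nonneg BG)
  linarith

end Representation

/-! ### Lipschitz constants of the curves -/

section Curves

variable {k G : ℝ → ℝ} {R B BG : ℝ} {L : NNReal} {a b : ℝ}

lemma exists_lipschitzWith_bumpLp (hk : IsWindow k R B L) (hG : IsWeight G BG) {h : ℝ}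
    (hh : 0 < h) (ha : 0 < a) (hb : b < 1) :
    ∃ Λ : NNReal, LipschitzWith Λ fun p : Icc a b => bumpLp hk hG hh p := by
  have h0 := hk.pos
  have h1 := hG.bound_nonneg
  refine ⟨⟨(√h)⁻¹ * L * h⁻¹ * BG * √(2 * (R * h + 1)), by positivity⟩,
    LipschitzWith.of_dist_le_mul fun p q => ?_⟩
  rw [dist_eq_norm, Subtype.dist_eq, Real.dist_eq]
  refine norm_bumpLp_sub_le hk hG hh ?_
  rw [abs_le]
  constructor <;> linarith [p.2.1, p.2.2, q.2.1, q.2.2]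

lemma exists_lipschitzWith_normalized (hk : IsWindow k R B L) (hG : IsWeight G BG) {h : ℝ}
    (hh : 0 < h) (ha : 0 < a) (hb : b < 1) {j : ℝ} (hj : 0 < j)
    (hjp : ∀ p ∈ Icc a b, j ≤ ‖bumpLp hk hG hh p‖ ^ 2) :
    ∃ Λ : NNReal, LipschitzWith Λ
      fun p : Icc a b => ‖bumpLp hk hG hh p‖⁻¹ • bumpLp hk hG hh p := by
  obtain ⟨Λ, hΛ⟩ := exists_lipschitzWith_bumpLp (a := a) (b := b) hk hG hh ha hb
  have hδ : 0 < √j := Real.sqrt_pos.2 hj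
  have hnorm (p : Icc a b) : √j ≤ ‖bumpLp hk hG hh p‖ :=
    (Real.sqrt_le_left (norm_nonneg _)).2 (hjp p p.2)
  refine ⟨2 * (√j).toNNReal⁻¹ * Λ, LipschitzWith.of_dist_le_mul fun p q => ?_⟩
  rw [dist_eq_norm]
  refine (norm_normalize_sub_le hδ (hnorm p) (hnorm q)).trans ?_
  push_cast
  rw [Real.coe_toNNReal _ hδ.le, mul_assoc _ (Λ : ℝ)]
  have h1 := hΛ.dist_le_mul p q
  rw [dist_eq_norm] at h1
  gcongr

end Curves

/-! ### The stochastic order -/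

section Rate

variable {Ω : Type*} [MeasurableSpace Ω] {ν : Measure Ω}

/-- Chebyshev's inequality in the form needed for the stochastic order. -/
lemma measure_lt_abs_le {ξ Z : Ω → ℝ} (hξ : ∀ ω, |ξ ω| ≤ Z ω) {A r D : ℝ}
    (hA : 0 < A) (hr : 0 < r) (hZm : AEMeasurable Z ν)
    (hZ : ∫⁻ ω, ENNReal.ofReal (Z ω ^ 2) ∂ν ≤ ENNReal.ofReal (D * r ^ 2)) :
    ν {ω | A * r < |ξ ω|} ≤ ENNReal.ofReal (D / A ^ 2) := by
  have h1 : {ω | A * r < |ξ ω|} ⊆ {ω | ENNReal.ofReal ((A * r) ^ 2) ≤ ENNReal.ofReal (Z ω ^ 2)} := by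
    intro ω hω
    exact ENNReal.ofReal_le_ofReal
      (pow_le_pow_left₀ (by positivity) (le_of_lt (lt_of_lt_of_le hω (hξ ω))) 2)
  have h0 : 0 < (A * r) ^ 2 := by positivity
  have h2 := meas_ge_le_lintegral_div (hZm.pow_const 2).ennreal_ofReal (μ := ν)
    (ε := ENNReal.ofReal ((A * r) ^ 2)) (ENNReal.ofReal_pos.2 h0).ne' ENNReal.ofReal_ne_top
  refine (measure_mono h1).trans (h2.trans ((ENNReal.div_le_div_right hZ _).trans (le_of_eq ?_)))
  rw [← ENNReal.ofReal_div_of_pos h0]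
  congr 1
  field_simp

/-- Once `log h^{-3/2} ≥ 1`, the square of the rate `h^{1/2} √(log h^{-3/2})` is at least `h`. -/
lemma eventually_le_sq_rate :
    ∀ᶠ h in 𝓝[>] (0 : ℝ), h ≤ (h ^ (1 / 2 : ℝ) * √(Real.log (h ^ (-(3 / 2) : ℝ)))) ^ 2 := by
  have h1 : Tendsto (fun h : ℝ => Real.log (h ^ (-(3 / 2) : ℝ))) (𝓝[>] 0) atTop :=
    Real.tendsto_log_atTop.comp (tendsto_rpow_neg_nhdsGT_zero (by norm_num))
  filter_upwards [h1.eventually_ge_atTop 1, self_mem_nhdsWithin] with h h2 h3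
  have h3' : 0 < h := h3
  rw [mul_pow, Real.sq_sqrt (by linarith), ← Real.sqrt_eq_rpow, Real.sq_sqrt h3'.le]
  exact le_mul_of_one_le_right h3'.le h2

end Rate

/-! ### The supremum of the coupled processes -/

lemma abs_iSup_sub_iSup_le {a b : ℝ} (hab : a ≤ b) (x y : C(Icc a b, ℝ)) :
    |(⨆ p, x p) - ⨆ p, y p| ≤ ‖x - y‖ := by
  have h1 := EllInf.abs_iSup_sub_iSup_le (S := (univ : Set (Icc a b)))
    ⟨⟨a, left_mem_Icc.2 hab⟩, mem_univ _⟩ (reindex (T := Icc a b) id x) (reindex id y)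
  rw [EllInf.iSup_univ, EllInf.iSup_univ] at h1
  refine h1.trans (lp.norm_le_of_forall_le (norm_nonneg _) fun t => ?_)
  exact (x - y).norm_coe_le_norm t

/-- The change of index `s ↦ h s` from the rescaled region to `[a, b]`. -/
def unscale {a b h : ℝ} (hh : 0 < h) (s : scaled a b h) : Icc a b :=
  ⟨h * s, by
    obtain ⟨p, hp, hs⟩ := s.2
    have h1 : h * (s : ℝ) = p := by
      rw [← hs]
      exact mul_inv_cancel_left₀ hh.ne' p
    rwa [h1]⟩

lemma unscale_scale {a b h : ℝ} (hh : 0 < h) (p : Icc a b) : unscale hh (scale h p) = p :=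
  Subtype.ext (mul_inv_cancel_left₀ hh.ne' (p : ℝ))

end MTE

open MTE

theorem lemma3 {Ω : Type*} [MeasurableSpace Ω] (μ : Measure Ω) [IsProbabilityMeasure μ]
    {d m : ℕ} (M : MTE.Model Ω d m) (a₀ b₀ C η : ℝ) (fP mreg sigma2 K : ℝ → ℝ)
    (hM : M.Framework μ) (hR : MTE.Regularity M μ a₀ b₀ C η fP mreg sigma2 K) :
    -- the process `B̃_{n,1}` exists for every `n ≥ 1`
    (∀ n : ℕ, 1 ≤ n → ∃ (Ω₁ : Type) (_ : MeasurableSpace Ω₁) (ν₁ : Measure Ω₁)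
      (B₁ : Ω₁ → MTE.EllInf (Icc a₀ b₀)),
      MTE.IsTightGaussian ν₁ (Icc a₀ b₀) B₁ (M.cov1 μ mreg K (MTE.bw C η n))) ∧
    -- the stationary process `B̃_{n,2}` exists for every large `n`
    ∃ (N : ℕ) (Ω₂ : Type) (_ : MeasurableSpace Ω₂) (ν₂ : Measure Ω₂)
      (B₂ : (n : ℕ) → Ω₂ → MTE.EllInf (MTE.scaled a₀ b₀ (MTE.bw C η n))),
      (∀ n : ℕ, N ≤ n → MTE.IsTightGaussian ν₂ (MTE.scaled a₀ b₀ (MTE.bw C η n)) (B₂ n)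
        (fun p q => MTE.rho K (p - q))) ∧
      -- every sequence `W̃_{n,1}` distributed as the suprema of `B̃_{n,1}`, on any probability space
      ∀ (Ω₁ : ℕ → Type*) [∀ n, MeasurableSpace (Ω₁ n)] (ν₁ : ∀ n, Measure (Ω₁ n))
        (B₁ : ∀ n, Ω₁ n → MTE.EllInf (Icc a₀ b₀))
        (Ω' : Type*) [MeasurableSpace Ω'] (μ' : Measure Ω') [IsProbabilityMeasure μ']
        (W₁ : ℕ → Ω' → ℝ),
        (∀ n : ℕ, 1 ≤ n → MTE.IsTightGaussian (ν₁ n) (Icc a₀ b₀) (B₁ n)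
          (M.cov1 μ mreg K (MTE.bw C η n))) →
        (∀ n : ℕ, 1 ≤ n →
          IdentDistrib (W₁ n) (fun ω => ⨆ p : Icc a₀ b₀, B₁ n ω p) μ' (ν₁ n)) →
        -- is approximated by a sequence `W̃_{n,2}` on that space enlarged by a uniform variable
        ∃ W₂ : ℕ → Ω' × unitInterval → ℝ,
          (∀ n : ℕ, N ≤ n →
            IdentDistrib (W₂ n)
              (fun ω => ⨆ p : Icc a₀ b₀, B₂ n ω (MTE.scale (MTE.bw C η n) p))
              (μ'.prod volume) ν₂) ∧
          MTE.IsBigOP (μ'.prod volume) (fun n ω => W₁ n ω.1 - W₂ n ω)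
            (fun n => MTE.bw C η n ^ (1 / 2 : ℝ) *
              Real.sqrt (Real.log (MTE.bw C η n ^ (-(3 / 2) : ℝ)))) := by
  obtain ⟨Lg, hLg⟩ := hR.sigma2_density_lipschitz
  obtain ⟨BG, hG⟩ := exists_isWeight_sqrtWeight hLg
  obtain ⟨R, B, L, hk⟩ := exists_isWindow_linearKernel hR.kernel_compact hR.kernel_diff
  obtain ⟨j, hj, hjn⟩ := hR.exists_le_norm_sq hM hk hG
  have hab := hR.a_lt_b
  have hη : 0 < η := lt_trans (by norm_num) hR.eta_lower
  have hpos (n : ℕ) (hn : 1 ≤ n) : 0 < bw C η n := bw_pos hR.C_pos hn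
  have ha₀ : a₀ ∈ Icc a₀ b₀ := left_mem_Icc.2 hab.le
  have hl : 0 < ∫ u, linearKernel K u ^ 2 := integral_linearKernel_sq_pos hk hG (hpos 1 le_rfl)
    (hj.trans_le (hjn 1 le_rfl (hpos 1 le_rfl) a₀ ha₀))
  obtain ⟨Cd, h₀, hCd, hh₀, hdiff⟩ := exists_diffCurve_bound hk hG Lg.coe_nonneg
    (abs_sq_sqrtWeight_sub_le hLg) hR.a_pos hR.b_lt_one hj hl
  obtain ⟨Ω₂, mΩ₂, ν₂, hν₂, J, hJ⟩ := exists_isonormal (Lp ℝ 2 (volume : Measure ℝ))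
  -- continuous versions of the two processes, built from the same isonormal process
  have hX₁ (n : ℕ) (hn : 1 ≤ n) : ∃ X : Ω₂ → C(Icc a₀ b₀, ℝ), StronglyMeasurable X ∧
      ∀ p : Icc a₀ b₀, (fun ω => X ω p) =ᵐ[ν₂]
        J (‖bumpLp hk hG (hpos n hn) p‖⁻¹ • bumpLp hk hG (hpos n hn) p) := by
    obtain ⟨Λ, hΛ⟩ := exists_lipschitzWith_normalized hk hG (hpos n hn) hR.a_pos hR.b_lt_one hj
      (hjn n hn (hpos n hn))
    exact exists_continuous_version hab J hΛ
  have hX₂ (n : ℕ) (hn : 1 ≤ n) : ∃ X : Ω₂ → C(Icc a₀ b₀, ℝ), StronglyMeasurable X ∧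
      ∀ p : Icc a₀ b₀, (fun ω => X ω p) =ᵐ[ν₂] J ((√(∫ u, linearKernel K u ^ 2))⁻¹ •
        bumpLp hk isWeight_one (hpos n hn) p) := by
    obtain ⟨Λ, hΛ⟩ := exists_lipschitzWith_bumpLp (a := a₀) (b := b₀) hk isWeight_one (hpos n hn)
      hR.a_pos hR.b_lt_one
    exact exists_continuous_version hab J
      ((lipschitzWith_smul (√(∫ u, linearKernel K u ^ 2))⁻¹).comp hΛ)
  choose X₁ hX₁m hX₁J using hX₁
  choose X₂ hX₂m hX₂J using hX₂
  have hB₁ (n : ℕ) (hn : 1 ≤ n) : IsTightGaussian ν₂ (Icc a₀ b₀)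
      (fun ω => reindex id (X₁ n hn ω)) (M.cov1 μ mreg K (bw C η n)) :=
    isTightGaussian_reindex hJ (hX₁m n hn) (hX₁J n hn) id
      fun s t => hR.cov1_eq hM hk hG (hpos n hn) s t
  refine ⟨fun n hn => ⟨Ω₂, mΩ₂, ν₂, _, hB₁ n hn⟩, 1, Ω₂, mΩ₂, ν₂, fun n ω =>
    if hn : 1 ≤ n then reindex (unscale (hpos n hn)) (X₂ n hn ω) else 0, fun n hn => ?_, ?_⟩
  · simp only [hn, dite_true]
    exact isTightGaussian_reindex hJ (hX₂m n hn) (hX₂J n hn) (unscale (hpos n hn))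
      fun s t => rho_eq hk (hpos n hn) s t
  intro Ω₁ _ ν₁ B₁ Ω' _ μ' _ W₁ hB₁' hW₁
  have : Nonempty (Icc a₀ b₀) := ⟨⟨a₀, ha₀⟩⟩
  -- the given variables have the law of the supremum of the first constructed process
  have hid (n : ℕ) (hn : 1 ≤ n) : IdentDistrib (W₁ n) (fun ω => ⨆ p, X₁ n hn ω p) μ' ν₂ :=
    (hW₁ n hn).trans ((hB₁' n hn).identDistrib_iSup (hB₁ n hn))
  have hcont : Continuous fun x : C(Icc a₀ b₀, ℝ) => ⨆ p, x p := by
    refine (LipschitzWith.of_dist_le_mul (K := 1) fun x y => ?_).continuous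
    rw [NNReal.coe_one, one_mul, dist_eq_norm, dist_eq_norm]
    exact abs_iSup_sub_iSup_le hab.le x y
  have hcoup (n : ℕ) : ∃ W₂ : Ω' × unitInterval → ℝ, ∀ hn : 1 ≤ n,
      IdentDistrib (fun ω => (W₁ n ω.1, W₂ ω))
        (fun ω => (⨆ p, X₁ n hn ω p, ⨆ p, X₂ n hn ω p)) (μ'.prod volume) ν₂ := by
    by_cases hn : 1 ≤ n
    · obtain ⟨W₂, hW₂⟩ := exists_coupling (Y₂ := fun ω => ⨆ p, X₂ n hn ω p)
        (hcont.comp_stronglyMeasurable (hX₂m n hn)).measurable.aemeasurable (hid n hn)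
      exact ⟨W₂, fun _ => hW₂⟩
    · exact ⟨0, fun h => absurd h hn⟩
  choose W₂ hW₂ using hcoup
  refine ⟨W₂, fun n hn => ?_, ?_⟩
  · have h1 : (fun ω => ⨆ p : Icc a₀ b₀, (if hn : 1 ≤ n then
        reindex (unscale (hpos n hn)) (X₂ n hn ω) else 0 : EllInf (scaled a₀ b₀ (bw C η n)))
          (scale (bw C η n) p)) = fun ω => ⨆ p, X₂ n hn ω p := by
      funext ω
      simp only [hn, dite_true, reindex_apply, unscale_scale]
    rw [h1]
    exact (hW₂ n hn).comp measurable_snd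
  -- the maximal inequality gives `E ‖X₁ - X₂‖² = O(h)`
  set D := Cd ^ 2 + 2 * Cd * Cd * (b₀ - a₀) with hD
  have hD0 : 0 ≤ D := by
    have : 0 ≤ b₀ - a₀ := sub_nonneg.2 hab.le
    positivity
  intro ε hε
  refine ⟨√(D / ε) + 1, by positivity, ?_⟩
  have hbw : Tendsto (fun n => bw C η n) atTop (𝓝[>] 0) :=
    tendsto_nhdsWithin_iff.2 ⟨tendsto_bw hη, (eventually_ge_atTop 1).mono fun n hn => hpos n hn⟩
  filter_upwards [eventually_ge_atTop 1, (tendsto_bw (C := C) hη).eventually_lt_const hh₀,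
    hbw.eventually eventually_le_sq_rate] with n hn hnh₀ hrate
  set h := bw C η n with hh
  set r := h ^ (1 / 2 : ℝ) * √(Real.log (h ^ (-(3 / 2) : ℝ))) with hr
  have hh0 : 0 < h := hpos n hn
  have hr0 : 0 < r := by
    have h1 : 0 ≤ r := mul_nonneg (Real.rpow_nonneg hh0.le _) (Real.sqrt_nonneg _)
    refine h1.lt_of_ne fun h2 => ?_
    rw [← h2, zero_pow two_ne_zero] at hrate
    exact absurd hrate (not_le.2 hh0)
  obtain ⟨hsize, hlip⟩ := hdiff h hh0 hnh₀ (hjn n hn hh0)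
  have hsecond : ∫⁻ ω, ENNReal.ofReal (‖(X₁ n hn - X₂ n hn) ω‖ ^ 2) ∂ν₂
      ≤ ENNReal.ofReal (D * r ^ 2) := by
    refine (lintegral_norm_sq_le hab J (f := fun p : Icc a₀ b₀ => diffCurve hk hG hh0 p)
      (s := Cd * h) (L := ⟨Cd, hCd⟩) (fun p => hsize p p.2)
      (LipschitzWith.of_dist_le_mul fun p q => ?_) fun p => ?_).trans ?_
    · rw [dist_eq_norm, Subtype.dist_eq, Real.dist_eq]
      exact hlip p p.2 q q.2
    · filter_upwards [hX₁J n hn p, hX₂J n hn p, Lp.coeFn_sub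
        (J (‖bumpLp hk hG hh0 p‖⁻¹ • bumpLp hk hG hh0 p))
        (J ((√(∫ u, linearKernel K u ^ 2))⁻¹ • bumpLp hk isWeight_one hh0 p))] with ω h1 h2 h3
      rw [diffCurve, map_sub, h3, Pi.sub_apply, Pi.sub_apply, ContinuousMap.sub_apply, h1, h2]
    · refine ENNReal.ofReal_le_ofReal ?_
      have hh1 : h ≤ 1 := hR.bw_le_one n hn
      have h1 : (Cd * h) ^ 2 + 2 * (Cd * h) * Cd * (b₀ - a₀) ≤ D * h := by
        have h2 : h ^ 2 ≤ h := by nlinarith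
        have h3 : Cd ^ 2 * h ^ 2 ≤ Cd ^ 2 * h := by gcongr
        rw [hD]
        nlinarith
      exact h1.trans (mul_le_mul_of_nonneg_left hrate hD0)
  have hcheb := measure_lt_abs_le (ν := ν₂)
    (ξ := fun ω => (⨆ p, X₁ n hn ω p) - ⨆ p, X₂ n hn ω p)
    (Z := fun ω => ‖(X₁ n hn - X₂ n hn) ω‖) (A := √(D / ε) + 1) (r := r) (D := D)
    (fun ω => abs_iSup_sub_iSup_le hab.le _ _) (by positivity) hr0
    (((hX₁m n hn).sub (hX₂m n hn)).norm.measurable.aemeasurable) hsecond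
  have hlaw : (μ'.prod volume) {ω | (√(D / ε) + 1) * r < |W₁ n ω.1 - W₂ n ω|}
      = ν₂ {ω | (√(D / ε) + 1) * r < |(⨆ p, X₁ n hn ω p) - ⨆ p, X₂ n hn ω p|} := by
    have hs : MeasurableSet {x : ℝ × ℝ | (√(D / ε) + 1) * r < |x.1 - x.2|} :=
      measurableSet_lt measurable_const
        (continuous_abs.measurable.comp (measurable_fst.sub measurable_snd))
    exact (hW₂ n hn).measure_mem_eq hs
  rw [hlaw]
  refine hcheb.trans (ENNReal.ofReal_le_ofReal ?_)
  rw [div_le_iff₀ (by positivity)]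
  have h1 : D / ε ≤ (√(D / ε) + 1) ^ 2 := by
    calc D / ε = √(D / ε) ^ 2 := (Real.sq_sqrt (by positivity)).symm
      _ ≤ (√(D / ε) + 1) ^ 2 := by gcongr; linarith
  rw [div_le_iff₀ hε] at h1
  linarith
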